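/- Let $n\ge 1$ and let $\overline M$ be a smooth ($C^\infty$, Hausdorff, second countable) manifold of dimension $n+1$ with boundary $\partial M$ and interior $M$. All connections are smooth torsion-free linear connections on the tangent bundle. Two of them are projectively equivalent if $\hat\nabla_\xi\eta=\nabla_\xi\eta+\Upsilon(\xi)\eta+\Upsilon(\eta)\xi$ for a smooth one-form $\Upsilon$; one then writes $\hat\nabla=\nabla+\Upsilon$. A projective structure is a projective equivalence class of connections. Let $\operatorname{vol}$ be the bundle of volume densities and $\mathcal E(w)=\operatorname{vol}^{-w/(n+2)}$ the bundle of projective densities of weight $w$. A defining function for $\partial M$ on an open set $U\subset\overline M$ is a smooth $\rho:U\to[0,\infty)$ with $\rho^{-1}(0)=\partial M\cap U$ and $d\rho\neq 0$ along $\rho^{-1}(0)$. Suppose that $\overline M$ is endowed with a projective structure and that $\nabla$ is a connection on $M$ contained in the restriction to $M$ of the projective class such that - $\nabla$ is special: there is a smooth nowhere vanishing section $\kappa$ of $\operatorname{vol}(M)$ that is parallel for $\nabla$; - $\operatorname{Ric}^\nabla=0$; - for no point $x\in\partial M$ and no open neighbourhood $U$ of $x$ in $\overline M$ does $\nabla|_{U\cap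 M}$ extend to a smooth connection on $U$. Then: 1. $\nabla$ is projectively compact of order $1$: every $x\in\partial M$ has an open neighbourhood $U$ in $\overline M$ with a defining function $\rho$ for $\partial M$ on $U$ such that the connection $\nabla+\frac{d\rho}{\rho}$ on $U\cap M$ extends to a connection on $U$ that is smooth up to the boundary. 2. The section $|\kappa|^{-1/(n+2)}$ of $\mathcal E(1)$ over $M$, extended by zero to $\partial M$, is a defining density $\sigma$ for $\partial M$: it is a smooth section of $\mathcal E(1)$ over $\overline M$, its zero locus is exactly $\partial M$, and in local trivializations of $\mathcal E(1)$ induced by coordinate frames around boundary points it is represented by defining functions for $\partial M$. 3. $\sigma$ solves the first BGG equation on $\mathcal E(1)$ on all of $\overline M$: for every connection $\tilde\nabla$ on $\overline M$ in the projective class, $$\tilde\nabla_{(a}\tilde\nabla_{b)}\sigma+\tilde{\mathsf P}_{(ab)}\sigma=0,\qquad \tilde{\mathsf P}_{(ab)}=\tfrac1n\widetilde{\operatorname{Ric}}_{(ab)} .$$ -/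

import Mathlib

open Set Module FiberBundle
open scoped Manifold ContDiff Topology

noncomputable section

namespace ProjComp

/-! ### Densities on a vector space -/

/-- The line of densities of exponent `r` on an `m`-dimensional real vector space `V`: functions
`φ` of `m`-tuples of vectors which scale by `|det|^r` under a change of frame.  For `r = 1` these
are the volume densities, and exponent `r` is the `r`-th power of that line. -/
def Density (m : ℕ) (r : ℝ) (V : Type*) [AddCommGroup V] [Module ℝ V] :
    Submodule ℝ ((Fin m → V) → ℝ) where
  carrier := {φ | ∀ (b : Basis (Fin m) ℝ V) (v : Fin m → V), φ v = |b.det v| ^ r * φ b}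
  add_mem' := by
    intro φ ψ hφ hψ b v
    simp only [Pi.add_apply]
    rw [hφ b v, hψ b v]
    ring
  zero_mem' := by
    intro b v
    simp
  smul_mem' := by
    intro c φ hφ b v
    simp only [Pi.smul_apply, smul_eq_mul]
    rw [hφ b v]
    ring

/-- The density of exponent `r` with value `c` on the basis `b`. -/
def Density.ofBasis {m : ℕ} (r : ℝ) {V : Type*} [AddCommGroup V] [Module ℝ V]
    (b : Basis (Fin m) ℝ V) (c : ℝ) : Density m r V :=
  ⟨fun v => |b.det v| ^ r * c, by
    intro b' v
    have h : b.det v = b.det b' * b'.det v := by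
      conv_lhs => rw [AlternatingMap.eq_smul_basis_det b' b.det]
      simp
    change |b.det v| ^ r * c = |b'.det v| ^ r * (|b.det b'| ^ r * c)
    rw [h, abs_mul, Real.mul_rpow (abs_nonneg _) (abs_nonneg _)]
    ring⟩

/-- The power `|κ| ^ s` of a volume density `κ`, a density of exponent `s`. -/
def Density.absPow {m : ℕ} {V : Type*} [AddCommGroup V] [Module ℝ V]
    (κ : Density m 1 V) (s : ℝ) : Density m s V :=
  ⟨fun v => |κ.1 v| ^ s, by
    intro b v
    change |κ.1 v| ^ s = |b.det v| ^ s * |κ.1 b| ^ s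
    rw [κ.2 b v, Real.rpow_one, abs_mul, abs_abs, Real.mul_rpow (abs_nonneg _) (abs_nonneg _)]⟩

/-- Projective densities of weight `w` in dimension `n + 1`: densities of exponent
`-w / (n + 2)`. -/
abbrev ProjDensity (n : ℕ) (w : ℝ) (V : Type*) [AddCommGroup V] [Module ℝ V] :
    Submodule ℝ ((Fin (n + 1) → V) → ℝ) :=
  Density (n + 1) (-w / ((n : ℝ) + 2)) V

/-! ### Affine connections on open subsets of a manifold with boundary -/

/-- The model of `(n + 1)`-dimensional manifolds with boundary. -/
abbrev Mdl (n : ℕ) :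
    ModelWithCorners ℝ (EuclideanSpace ℝ (Fin (n + 1))) (EuclideanHalfSpace (n + 1)) :=
  modelWithCornersEuclideanHalfSpace (n + 1)

section Manifold

variable {n : ℕ} {M : Type*} [TopologicalSpace M] [ChartedSpace (EuclideanHalfSpace (n + 1)) M]

/-- Vector fields. -/
abbrev VField (n : ℕ) (M : Type*) [TopologicalSpace M]
    [ChartedSpace (EuclideanHalfSpace (n + 1)) M] : Type _ :=
  Π x : M, TangentSpace (Mdl n) x

/-- Raw operators `∇`; `∇ Y x v` is the derivative of the field `Y` at `x` in direction `v`. -/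
abbrev Conn (n : ℕ) (M : Type*) [TopologicalSpace M]
    [ChartedSpace (EuclideanHalfSpace (n + 1)) M] : Type _ :=
  VField n M → Π x : M, TangentSpace (Mdl n) x →L[ℝ] TangentSpace (Mdl n) x

/-- The standard basis of the tangent space at `x` (the coordinate frame at `x` of the preferred
chart at `x`). -/
def stdBasis (x : M) : Basis (Fin (n + 1)) ℝ (TangentSpace (Mdl n) x) :=
  (EuclideanSpace.basisFun (Fin (n + 1)) ℝ).toBasis

variable [IsManifold (Mdl n) ∞ M]

/-- A vector field that is smooth near `x` with value `v` at `x`: constant coefficients in the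
preferred chart at `x`. -/
def ext {x : M} (v : TangentSpace (Mdl n) x) : VField n M :=
  extend (EuclideanSpace ℝ (Fin (n + 1))) v

/-- The local coordinate frame around `x` of the preferred chart at `x`, evaluated at `y`. -/
def frame (x y : M) : Fin (n + 1) → TangentSpace (Mdl n) y :=
  fun i => ext (n := n) (stdBasis x i) y

/-- Differentiability of a vector field at a point. -/
def VField.DiffAt (X : VField n M) (x : M) : Prop :=
  MDifferentiableAt (Mdl n) ((Mdl n).prod 𝓘(ℝ, EuclideanSpace ℝ (Fin (n + 1))))
    (fun y => (⟨y, X y⟩ : TangentBundle (Mdl n) M)) x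

/-- Smoothness of a vector field on a set (up to the boundary). -/
def VField.IsSmoothOn (X : VField n M) (U : Set M) : Prop :=
  ContMDiffOn (Mdl n) ((Mdl n).prod 𝓘(ℝ, EuclideanSpace ℝ (Fin (n + 1)))) ∞
    (fun y => (⟨y, X y⟩ : TangentBundle (Mdl n) M)) U

/-- `D` is a smooth torsion-free affine connection on the open set `U` (its values off `U` are
irrelevant). -/
structure IsAffineConnectionOn (D : Conn n M) (U : Set M) : Prop where
  covariant : IsCovariantDerivativeOn (EuclideanSpace ℝ (Fin (n + 1))) D U
  smooth : ∀ V : Set M, IsOpen V → V ⊆ U →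
    ContMDiffCovariantDerivativeOn (EuclideanSpace ℝ (Fin (n + 1))) ∞ D V
  torsion_free : ∀ (X Y : VField n M) (x : M), x ∈ U →
    X.DiffAt x → Y.DiffAt x →
    D Y x (X x) - D X x (Y x) = VectorField.mlieBracket (Mdl n) X Y x

/-- One-forms. -/
abbrev OneForm (n : ℕ) (M : Type*) [TopologicalSpace M]
    [ChartedSpace (EuclideanHalfSpace (n + 1)) M] : Type _ :=
  Π x : M, TangentSpace (Mdl n) x →L[ℝ] ℝ

/-- Smoothness of a one-form on an open set, tested on locally defined smooth vector fields. -/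
def OneForm.IsSmoothOn (Υ : OneForm n M) (U : Set M) : Prop :=
  ∀ V : Set M, IsOpen V → V ⊆ U → ∀ X : VField n M, X.IsSmoothOn V →
    ContMDiffOn (Mdl n) 𝓘(ℝ) ∞ (fun x => Υ x (X x)) V

/-- `D' = D + Υ` on `U`, i.e. `D'_ξ η = D_ξ η + Υ(ξ) η + Υ(η) ξ`. -/
def IsProjectiveChangeOn (D D' : Conn n M) (Υ : OneForm n M) (U : Set M) : Prop :=
  ∀ x ∈ U, ∀ Y : VField n M, Y.DiffAt x → ∀ v : TangentSpace (Mdl n) x,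
    D' Y x v = D Y x v + Υ x v • Y x + Υ x (Y x) • v

/-- Projective equivalence on `U`. -/
def ProjEquivOn (D D' : Conn n M) (U : Set M) : Prop :=
  ∃ Υ : OneForm n M, Υ.IsSmoothOn U ∧ IsProjectiveChangeOn D D' Υ U

variable (n M) in
/-- A projective structure on `M`: a projective equivalence class of smooth torsion-free affine
connections (smooth up to the boundary). -/
structure ProjectiveStructure where
  carrier : Set (Conn n M)
  nonempty : carrier.Nonempty
  isAffine : ∀ D ∈ carrier, IsAffineConnectionOn D univ
  mem_iff : ∀ D ∈ carrier, ∀ D', IsAffineConnectionOn D' univ →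
    (D' ∈ carrier ↔ ProjEquivOn D D' univ)

/-- The affine connection `D` on `U` lies in the restriction to `U` of the projective structure. -/
def ProjectiveStructure.ContainsOn (p : ProjectiveStructure n M) (D : Conn n M) (U : Set M) :
    Prop :=
  IsAffineConnectionOn D U ∧ ∀ D' ∈ p.carrier, ProjEquivOn D' D U

/-- `D`, given on the interior, extends to an affine connection on `U`, smooth up to the
boundary. -/
def ExtendsTo (D : Conn n M) (U : Set M) : Prop :=
  ∃ D' : Conn n M, IsAffineConnectionOn D' U ∧
    ∀ x ∈ U ∩ (Mdl n).interior M, ∀ Y : VField n M, Y.DiffAt x → D' Y x = D Y x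

/-! ### Curvature -/

/-- The curvature `R(X, Y) Z = D_X D_Y Z - D_Y D_X Z - D_{[X, Y]} Z`. -/
def curvature (D : Conn n M) (X Y Z : VField n M) : VField n M := fun x =>
  D (fun y => D Z y (Y y)) x (X x) - D (fun y => D Z y (X y)) x (Y x)
    - D Z x (VectorField.mlieBracket (Mdl n) X Y x)

/-- The Ricci tensor `Ric(v, w) = tr (u ↦ R(u, v) w)`, computed with local extensions of the
vectors (curvature is tensorial). -/
def ricci (D : Conn n M) (x : M) (v w : TangentSpace (Mdl n) x) : ℝ :=
  ∑ i, (stdBasis x).repr (curvature D (ext (stdBasis x i)) (ext v) (ext w) x) i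

/-- Ricci-flatness on `U`. -/
def IsRicciFlatOn (D : Conn n M) (U : Set M) : Prop :=
  ∀ x ∈ U, ∀ v w : TangentSpace (Mdl n) x, ricci D x v w = 0

/-- The symmetric part of the projective Schouten tensor in dimension `n + 1`. -/
def schoutenSymm (D : Conn n M) (x : M) (v w : TangentSpace (Mdl n) x) : ℝ :=
  (1 / (n : ℝ)) * ((ricci D x v w + ricci D x w v) / 2)

/-! ### Sections of density bundles -/

variable (n M) in
/-- Sections of the bundle of densities of exponent `r`. -/
abbrev DensitySection (r : ℝ) : Type _ := Π x : M, Density (n + 1) r (TangentSpace (Mdl n) x)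

variable {r : ℝ}

/-- The representation of a section of a density bundle in the local trivialization given by the
coordinate frame around `x`. -/
def DensitySection.rep (s : DensitySection n M r) (x : M) : M → ℝ := fun y => (s y).1 (frame x y)

/-- Smoothness of a section of a density bundle on the open set `U`. -/
def DensitySection.IsSmoothOn (s : DensitySection n M r) (U : Set M) : Prop :=
  ∀ x ∈ U, ContMDiffAt (Mdl n) 𝓘(ℝ) ∞ (s.rep x) x

/-- The connection induced by `D` on densities of exponent `r`: for a local frame `e` with
`D_v e_j = ∑ i, ω_ij(v) e_i` one has `(D_v s)(e) = v (s(e)) - r tr(ω(v)) s(e)`. -/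
def DensitySection.covDeriv (D : Conn n M) (s : DensitySection n M r) (x : M)
    (v : TangentSpace (Mdl n) x) : Density (n + 1) r (TangentSpace (Mdl n) x) :=
  Density.ofBasis r (stdBasis x)
    (mvfderiv (Mdl n) (s.rep x) x v
      - r * (∑ i, (stdBasis x).repr (D (ext (stdBasis x i)) x v) i) * (s x).1 (stdBasis x))

/-- A section is parallel on `U`. -/
def DensitySection.IsParallelOn (D : Conn n M) (s : DensitySection n M r) (U : Set M) : Prop :=
  ∀ x ∈ U, ∀ v : TangentSpace (Mdl n) x, s.covDeriv D x v = 0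

/-- The second covariant derivative `D²_{v, w} s = D_V D_W s - D_{D_V W} s`, where `V`, `W` are
local extensions of `v`, `w` (the value does not depend on them). -/
def DensitySection.hess (D : Conn n M) (s : DensitySection n M r) (x : M)
    (v w : TangentSpace (Mdl n) x) : Density (n + 1) r (TangentSpace (Mdl n) x) :=
  DensitySection.covDeriv D (fun y => s.covDeriv D y (ext w y)) x v
    - s.covDeriv D x (D (ext w) x v)

/-- `σ`, a section of the bundle of projective densities of weight `1`, solves the first BGG
equation `D_(a D_b) σ + P_(ab) σ = 0` on all of `M`, for the connections `D` in the projective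
class. -/
def SolvesFirstBGG (p : ProjectiveStructure n M)
    (σ : Π x : M, ProjDensity n 1 (TangentSpace (Mdl n) x)) : Prop :=
  ∀ D ∈ p.carrier, ∀ (x : M) (v w : TangentSpace (Mdl n) x),
    (1 / 2 : ℝ) • (DensitySection.hess D σ x v w + DensitySection.hess D σ x w v)
      + schoutenSymm D x v w • σ x = 0

/-! ### Defining functions, defining densities, projective compactness -/

/-- `ρ` is a (local) defining function for the boundary on the open set `U`. -/
structure IsDefiningFunctionOn (ρ : M → ℝ) (U : Set M) : Prop where
  smooth : ContMDiffOn (Mdl n) 𝓘(ℝ) ∞ ρ U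
  nonneg : ∀ x ∈ U, 0 ≤ ρ x
  zero_iff : ∀ x ∈ U, ρ x = 0 ↔ x ∈ (Mdl n).boundary M
  deriv_ne : ∀ x ∈ U, ρ x = 0 → mvfderiv (Mdl n) ρ x ≠ 0

/-- `σ` is a defining density for the boundary: a smooth section on all of `M` whose zero locus is
the boundary and which is represented by defining functions in local trivializations around
boundary points. -/
structure IsDefiningDensity (σ : DensitySection n M r) : Prop where
  smooth : σ.IsSmoothOn univ
  zero_iff : ∀ x : M, σ x = 0 ↔ x ∈ (Mdl n).boundary M
  rep : ∀ x ∈ (Mdl n).boundary M, ∃ U : Set M, IsOpen U ∧ x ∈ U ∧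
    IsDefiningFunctionOn (n := n) (σ.rep x) U

/-- The connection `D` on the interior is projectively compact of order `α`: near each boundary
point, `D + dρ / (α ρ)` extends to the boundary for some local defining function `ρ`. -/
def IsProjectivelyCompact (α : ℝ) (D : Conn n M) : Prop :=
  ∀ x ∈ (Mdl n).boundary M, ∃ (U : Set M) (ρ : M → ℝ) (D' : Conn n M),
    IsOpen U ∧ x ∈ U ∧ IsDefiningFunctionOn (n := n) ρ U ∧ IsAffineConnectionOn D' U ∧
    IsProjectiveChangeOn D D' (fun y => (1 / (α * ρ y)) • mvfderiv (Mdl n) ρ y)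
      (U ∩ (Mdl n).interior M)

/-- The section `κ ^ (-1 / (n + 2))` of the bundle of projective densities of weight `1` determined
by a volume density `κ` (negative values of `κ` are replaced by their absolute value). -/
def weightOneDensity (κ : DensitySection n M 1) :
    Π x : M, ProjDensity n 1 (TangentSpace (Mdl n) x) :=
  fun x => Density.absPow (κ x) (-1 / ((n : ℝ) + 2))

open Classical in
/-- Extension by zero from the interior to all of `M`. -/
def DensitySection.extendByZero (s : DensitySection n M r) : DensitySection n M r :=
  fun x => if x ∈ (Mdl n).interior M then s x else 0

end Manifold

end ProjComp

end

/-! ### Total linear differential systems and their extension to the closure. -/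

namespace LinearSystem

variable {E : Type*} [NormedAddCommGroup E] [NormedSpace ℝ E]
  {ι J : Type*} [Fintype ι] [Fintype J]

/-! Choose a connection `D₀` in the projective class. It is smooth up to the boundary, and `D = D₀ +
Υ` on the interior. Put `σ = |κ|^(-1/(n+2))`. A projective change adds `(n+2)Υ` to the trace of the
connection, so `κ` being parallel for `D` becomes `D₀σ = -Υσ` (`covCoord_weightOneDensity`).
Differentiating once more and inserting the change of the Ricci tensor, `Ric^D = 0` becomes the
first BGG equation for `σ` with respect to `D₀` (`bggCoord_eq_zero`). The singular behaviour of `D`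
is thereby traded for a linear equation with coefficients smooth up to the boundary.

In a chart the BGG equation expresses all second derivatives of `σ` linearly through its 1-jet
(`pd_jet`), hence the 1-jet solves a closed first order linear system. By Grönwall along segments of
a half ball the 1-jet stays bounded. It is therefore Lipschitz, extends to the closure, and is
smooth there by bootstrapping (`LinearSystem.exists_extension`). Grönwall also shows that a solution
whose 1-jet vanishes at one point, boundary points included, is identically zero. Hence `dσ ≠ 0`
wherever the extended `σ` vanishes (`exists_smooth_extension`).

On the interior `Υ = -θ/(n+2) - dσ/σ`, where `θ` is the trace of the Christoffel symbols of `D₀`. If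
the extension of `σ` were nonzero at a boundary point, this formula would extend `Υ`, and so `D`,
across that point, which is excluded (`eq_zero_of_not_extendsTo`). So `σ` vanishes exactly on the
boundary and is locally a defining function. The same formula shows that `D + dσ/σ = D₀ - θ/(n+2)`
is smooth up to the boundary, which is projective compactness of order 1. The BGG equation passes to
the boundary by continuity, the interior being dense. -/

/-- The right hand side of the total linear differential system
`d u_α = ∑ j, (∑ β, a j α β * u_β) • L j`. -/
noncomputable def rhs (a : J → ι → ι → E → ℝ) (L : J → E →L[ℝ] ℝ) (z : E) (w : ι → ℝ) :
    E →L[ℝ] (ι → ℝ) :=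
  ContinuousLinearMap.pi fun α => ∑ j, (∑ β, a j α β z * w β) • L j

variable {a : J → ι → ι → E → ℝ} {L : J → E →L[ℝ] ℝ}

lemma exists_norm_rhs_le {K : Set E} (hK : IsCompact K)
    (ha : ∀ j α β, ContinuousOn (a j α β) K) :
    ∃ C : ℝ, 0 ≤ C ∧ ∀ z ∈ K, ∀ w, ‖rhs a L z w‖ ≤ C * ‖w‖ := by
  have h : ∀ j α β, ∃ B, 0 ≤ B ∧ ∀ z ∈ K, |a j α β z| ≤ B := by
    intro j α β
    obtain ⟨B, hB⟩ := hK.exists_bound_of_continuousOn (ha j α β)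
    exact ⟨max B 0, le_max_right _ _, fun z hz => (hB z hz).trans (le_max_left _ _)⟩
  choose B hB0 hB using h
  have hnn : ∀ α, 0 ≤ ∑ j, (∑ β, B j α β) * ‖L j‖ := fun α =>
    Finset.sum_nonneg fun j _ => mul_nonneg (Finset.sum_nonneg fun β _ => hB0 j α β) (norm_nonneg _)
  refine ⟨∑ α, ∑ j, (∑ β, B j α β) * ‖L j‖, Finset.sum_nonneg fun α _ => hnn α,
    fun z hz w => ?_⟩
  refine ContinuousLinearMap.opNorm_le_bound _ (by
    exact mul_nonneg (Finset.sum_nonneg fun α _ => hnn α) (norm_nonneg _)) fun v => ?_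
  refine (pi_norm_le_iff_of_nonneg (by
    have := Finset.sum_nonneg fun α (_ : α ∈ Finset.univ) => hnn α
    positivity)).2 fun α => ?_
  simp only [rhs, ContinuousLinearMap.coe_pi', sum_apply,
    smul_apply, smul_eq_mul]
  calc ‖∑ j, (∑ β, a j α β z * w β) * L j v‖
      ≤ ∑ j, ((∑ β, B j α β) * ‖L j‖) * (‖w‖ * ‖v‖) := by
        refine (norm_sum_le _ _).trans (Finset.sum_le_sum fun j _ => ?_)
        rw [norm_mul]
        have h1 : ‖∑ β, a j α β z * w β‖ ≤ (∑ β, B j α β) * ‖w‖ := by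
          rw [Finset.sum_mul]
          refine (norm_sum_le _ _).trans (Finset.sum_le_sum fun β _ => ?_)
          rw [norm_mul]
          exact mul_le_mul (hB j α β z hz) (norm_le_pi_norm w β) (norm_nonneg _) (hB0 j α β)
        calc _ ≤ ((∑ β, B j α β) * ‖w‖) * (‖L j‖ * ‖v‖) :=
              mul_le_mul h1 ((L j).le_opNorm v) (norm_nonneg _)
                (mul_nonneg (Finset.sum_nonneg fun β _ => hB0 j α β) (norm_nonneg _))
          _ = _ := by ring
    _ = (∑ j, (∑ β, B j α β) * ‖L j‖) * ‖w‖ * ‖v‖ := by rw [← Finset.sum_mul]; ring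
    _ ≤ _ := by
        gcongr
        exact Finset.single_le_sum (f := fun α => ∑ j, (∑ β, B j α β) * ‖L j‖)
          (fun α _ => hnn α) (Finset.mem_univ α)

/-- Along a segment, a solution grows at most exponentially. -/
lemma norm_le_of_segment {K : Set E} (hK : Convex ℝ K) {C : ℝ}
    (hC : ∀ z ∈ K, ∀ w, ‖rhs a L z w‖ ≤ C * ‖w‖) {u : E → ι → ℝ}
    (hu : ∀ z ∈ K, HasFDerivWithinAt u (rhs a L z (u z)) K z) {p q : E} (hp : p ∈ K)
    (hq : q ∈ K) : ‖u q‖ ≤ ‖u p‖ * Real.exp (C * ‖q - p‖) := by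
  set γ : ℝ → E := fun t => p + t • (q - p) with hγ
  have hγK : ∀ t ∈ Icc (0 : ℝ) 1, γ t ∈ K := fun t ht => hK.add_smul_sub_mem hp hq ht
  have hγd : ∀ t, HasDerivAt γ (q - p) t := fun t => by
    simpa [hγ] using ((hasDerivAt_id t).smul_const (q - p)).const_add p
  have hd : ∀ t ∈ Icc (0 : ℝ) 1, HasDerivWithinAt (u ∘ γ) (rhs a L (γ t) (u (γ t)) (q - p))
      (Icc 0 1) t := fun t ht =>
    (hu _ (hγK t ht)).comp_hasDerivWithinAt t (hγd t).hasDerivWithinAt hγK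
  have key := norm_le_gronwallBound_of_norm_deriv_right_le (f := u ∘ γ)
    (f' := fun t => rhs a L (γ t) (u (γ t)) (q - p)) (δ := ‖u p‖) (K := C * ‖q - p‖) (ε := 0)
    (a := 0) (b := 1) (fun t ht => (hd t ht).continuousWithinAt)
    (fun t ht => ((hd t ⟨ht.1, ht.2.le⟩).mono_of_mem_nhdsWithin
      (Icc_mem_nhdsGE_of_mem ht))) (by simp [hγ])
    (fun t ht => by
      calc _ ≤ ‖rhs a L (γ t) (u (γ t))‖ * ‖q - p‖ := ContinuousLinearMap.le_opNorm _ _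
        _ ≤ C * ‖u (γ t)‖ * ‖q - p‖ := by
            gcongr
            exact hC _ (hγK t ⟨ht.1, ht.2.le⟩) _
        _ = _ := by simp only [Function.comp]; ring)
    1 (by simp)
  simpa [gronwallBound_ε0, hγ] using key

/-- Bootstrapping: the derivative of `v` is a smooth expression in the point and `v`, so each order
of regularity of `v` gives the next one. -/
lemma contDiffOn_of_hasFDerivWithinAt {K : Set E} (hK : UniqueDiffOn ℝ K)
    (ha : ∀ j α β, ContDiffOn ℝ ∞ (a j α β) K) {v : E → ι → ℝ}
    (hv : ∀ z ∈ K, HasFDerivWithinAt v (rhs a L z (v z)) K z) : ContDiffOn ℝ ∞ v K := by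
  refine contDiffOn_infty.2 fun k => ?_
  induction k with
  | zero => exact contDiffOn_zero.2 fun z hz => (hv z hz).continuousWithinAt
  | succ k ih =>
    have h : ContDiffOn ℝ k (fun z => rhs a L z (v z)) K := by
      have h1 : ∀ α, ContDiffOn ℝ k (fun z => ∑ j, (∑ β, a j α β z * v z β) • L j) K := fun α =>
        ContDiffOn.sum fun j _ => ContDiffOn.smul (ContDiffOn.sum fun β _ =>
          ((ha j α β).of_le (by exact_mod_cast le_top)).mul (contDiffOn_pi.1 ih β))
          contDiffOn_const
      have h2 := contDiffOn_pi.2 h1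
      exact (ContinuousLinearMap.piEquivL (ι := ι) ℝ E (fun _ => ℝ)).contDiff.comp_contDiffOn h2
    push_cast
    rw [contDiffOn_succ_iff_fderivWithin hK]
    refine ⟨fun z hz => (hv z hz).differentiableWithinAt, by simp, ?_⟩
    exact h.congr fun z hz => (hv z hz).fderivWithin (hK z hz)

/-- A solution of a total linear differential system on a bounded convex open set extends smoothly
to the closure when the coefficients are smooth on the closure. -/
theorem exists_extension {Ω : Set E} (hΩ : IsOpen Ω) (hconv : Convex ℝ Ω) (hne : Ω.Nonempty)
    (hK : IsCompact (closure Ω)) (ha : ∀ j α β, ContDiffOn ℝ ∞ (a j α β) (closure Ω))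
    {u : E → ι → ℝ} (hu : ∀ z ∈ Ω, HasFDerivAt u (rhs a L z (u z)) z) :
    ∃ v : E → ι → ℝ, EqOn v u Ω ∧ ContDiffOn ℝ ∞ v (closure Ω) ∧
      (∀ z ∈ closure Ω, HasFDerivWithinAt v (rhs a L z (v z)) (closure Ω) z) ∧
      ∀ z ∈ closure Ω, v z = 0 → ∀ p ∈ closure Ω, v p = 0 := by
  obtain ⟨C, hC0, hC⟩ := exists_norm_rhs_le (L := L) hK fun j α β => (ha j α β).continuousOn
  obtain ⟨p, hp⟩ := hne
  obtain ⟨R, hR⟩ := hK.isBounded.exists_norm_le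
  -- All points of `Ω` have norm at most `R`, so every segment from `p` has length at most `R + R`
  -- and Grönwall gives one bound for all of `Ω`.
  have hbd : ∀ z ∈ Ω, ‖u z‖ ≤ ‖u p‖ * Real.exp (C * (R + R)) := by
    intro z hz
    refine (norm_le_of_segment hconv (fun z hz => hC z (subset_closure hz))
      (fun z hz => (hu z hz).hasFDerivWithinAt) hp hz).trans ?_
    gcongr
    exact (norm_sub_le _ _).trans
      (add_le_add (hR z (subset_closure hz)) (hR p (subset_closure hp)))
  set B : NNReal := ⟨C * (‖u p‖ * Real.exp (C * (R + R))), by positivity⟩ with hB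
  have hlip : LipschitzOnWith B u Ω :=
    hconv.lipschitzOnWith_of_nnnorm_hasFDerivWithin_le
      (fun z hz => (hu z hz).hasFDerivWithinAt) fun z hz => by
        rw [← NNReal.coe_le_coe, coe_nnnorm]
        exact (hC z (subset_closure hz) _).trans (mul_le_mul_of_nonneg_left (hbd z hz) hC0)
  -- A Lipschitz extension to the whole space fixes the boundary values. Only its restriction to the
  -- closure matters.
  obtain ⟨v, hv, hvu⟩ := hlip.extend_finite_dimension
  have hvu' : EqOn v u Ω := fun z hz => (hvu hz).symm
  have hvd : ∀ z ∈ Ω, HasFDerivAt v (rhs a L z (v z)) z := fun z hz => by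
    rw [hvu' hz]
    exact (hu z hz).congr_of_eventuallyEq
      (Filter.eventuallyEq_of_mem (hΩ.mem_nhds hz) hvu')
  have hcont : ContinuousOn (fun z => rhs a L z (v z)) (closure Ω) := by
    have h1 : ∀ α, ContinuousOn (fun z => ∑ j, (∑ β, a j α β z * v z β) • L j) (closure Ω) :=
      fun α => continuousOn_finsetSum _ fun j _ => ContinuousOn.smul
        (continuousOn_finsetSum _ fun β _ => (ha j α β).continuousOn.mul
          ((continuous_apply β).comp hv.continuous).continuousOn) continuousOn_const
    exact (ContinuousLinearMap.piEquivL (ι := ι) ℝ E (fun _ => ℝ)).continuous.comp_continuousOn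
      (continuousOn_pi.2 h1)
  -- On `Ω` the derivative is the right hand side, which is continuous on the closure. A continuous
  -- function whose derivative has a limit at a point of the closure of a convex open set is
  -- differentiable there, with that limit.
  have hvK : ∀ z ∈ closure Ω, HasFDerivWithinAt v (rhs a L z (v z)) (closure Ω) z := by
    intro z hz
    refine hasFDerivWithinAt_closure_of_tendsto_fderiv
      (fun y hy => (hvd y hy).differentiableAt.differentiableWithinAt) hconv hΩ
      (fun y _ => hv.continuous.continuousWithinAt) ?_
    refine Filter.Tendsto.congr' ?_ ((hcont z hz).mono subset_closure)
    filter_upwards [self_mem_nhdsWithin] with y hy using (hvd y hy).fderiv.symm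
  refine ⟨v, hvu', contDiffOn_of_hasFDerivWithinAt ?_ ha hvK, hvK, fun z hz hz0 q hq => ?_⟩
  · exact uniqueDiffOn_convex hconv.closure
      ⟨p, interior_mono subset_closure (hΩ.interior_eq.symm ▸ hp)⟩
  -- The system holds on the closed set too, so Grönwall may start at a boundary point.
  · have := norm_le_of_segment hconv.closure hC hvK hz hq
    rw [hz0, norm_zero, zero_mul] at this
    exact norm_le_zero_iff.1 this

end LinearSystem

/-! ### Coordinate frames and partial derivatives up to the boundary. -/

noncomputable section

namespace ProjComp

variable {n : ℕ} {M : Type*} [TopologicalSpace M] [ChartedSpace (EuclideanHalfSpace (n + 1)) M]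

/-- The domain of the preferred chart at `x`. -/
abbrev chartDom (n : ℕ) {M : Type*} [TopologicalSpace M]
    [ChartedSpace (EuclideanHalfSpace (n + 1)) M] (x : M) : Set M :=
  (chartAt (EuclideanHalfSpace (n + 1)) x).source

lemma chartDom_mem_nhds {x y : M} (hy : y ∈ chartDom n x) : chartDom n x ∈ 𝓝 y :=
  (chartAt (EuclideanHalfSpace (n + 1)) x).open_source.mem_nhds hy

lemma mem_chartDom (x : M) : x ∈ chartDom n x := mem_chart_source _ x

/-- Smooth real functions near a point. -/
abbrev SmoothFnAt (n : ℕ) {M : Type*} [TopologicalSpace M]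
    [ChartedSpace (EuclideanHalfSpace (n + 1)) M] (f : M → ℝ) (x : M) : Prop :=
  ContMDiffAt (Mdl n) 𝓘(ℝ) ∞ f x

lemma two_le_infty : (2 : ℕ∞ω) ≤ ∞ := by
  change ((2 : ℕ∞) : ℕ∞ω) ≤ ((⊤ : ℕ∞) : ℕ∞ω)
  exact WithTop.coe_le_coe.2 le_top

lemma extChartAt_mem_range {x y : M} (hy : y ∈ chartDom n x) :
    extChartAt (Mdl n) x y ∈ range (Mdl n) :=
  extChartAt_target_subset_range x ((extChartAt (Mdl n) x).map_source (by simpa using hy))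

lemma SmoothFnAt.mdiff {f : M → ℝ} {x : M} (h : SmoothFnAt n f x) :
    MDifferentiableAt (Mdl n) 𝓘(ℝ) f x :=
  ContMDiffAt.mdifferentiableAt h (by simp)

variable [IsManifold (Mdl n) ∞ M]

lemma SmoothFnAt.eventually_mdiff {f : M → ℝ} {x : M} (h : SmoothFnAt n f x) :
    ∀ᶠ y in 𝓝 x, MDifferentiableAt (Mdl n) 𝓘(ℝ) f y := by
  have h1 : ContMDiffAt (Mdl n) 𝓘(ℝ) 1 f x := h.of_le (by simp)
  filter_upwards [(contMDiffAt_iff_contMDiffAt_nhds (by simp)).1 h1] with y hy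
  exact hy.mdifferentiableAt (by simp)

/-- Smoothness of a vector field at a point. -/
def VField.SmoothAt (X : VField n M) (x : M) : Prop :=
  ContMDiffAt (Mdl n) ((Mdl n).prod 𝓘(ℝ, EuclideanSpace ℝ (Fin (n + 1)))) ∞
    (fun y => (⟨y, X y⟩ : TangentBundle (Mdl n) M)) x

lemma VField.SmoothAt.diffAt {X : VField n M} {x : M} (h : X.SmoothAt x) : X.DiffAt x :=
  ContMDiffAt.mdifferentiableAt h (by simp)

/-- The coordinate vector fields of the preferred chart at `x`. -/
abbrev coordField (x : M) (i : Fin (n + 1)) : VField n M := ext (stdBasis x i)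

variable (n) in
/-- The trivialization of the tangent bundle given by the preferred chart at `x`. -/
abbrev chartTriv (x : M) : Bundle.Trivialization (EuclideanSpace ℝ (Fin (n + 1)))
    (Bundle.TotalSpace.proj : TangentBundle (Mdl n) M → M) :=
  trivializationAt (EuclideanSpace ℝ (Fin (n + 1))) (TangentSpace (Mdl n)) x

lemma mem_chartTriv {x y : M} (hy : y ∈ chartDom n x) : y ∈ (chartTriv n x).baseSet := by
  simpa using hy

/-- The coefficients of a tangent vector at `y` with respect to the coordinate fields of the
preferred chart at `x`. -/
def coordCoeff (x : M) (i : Fin (n + 1)) (y : M) : TangentSpace (Mdl n) y →L[ℝ] ℝ :=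
  (EuclideanSpace.proj i : EuclideanSpace ℝ (Fin (n + 1)) →L[ℝ] ℝ) ∘L
    (chartTriv n x).continuousLinearMapAt ℝ y

/-- A tangent vector as an element of the model space. -/
def modelVec {x : M} (v : TangentSpace (Mdl n) x) : EuclideanSpace ℝ (Fin (n + 1)) := v

/-- The trivialization of the chart at `x` is the identity on the fibre over `x`, so `v` itself
serves as the constant coefficient vector. -/
lemma ext_eq {x y : M} (hy : y ∈ chartDom n x) (v : TangentSpace (Mdl n) x) :
    ext v y = (chartTriv n x).symmL ℝ y (modelVec v) := by
  rw [(chartTriv n x).symmL_apply (mem_chartTriv hy)]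
  change (chartTriv n x).symm y _ = _
  exact congrArg ((chartTriv n x).symm y)
    ((tangentBundleCore (Mdl n) M).coordChange_self (achart _ x) x (mem_chart_source _ x) v)

lemma coordField_eq {x y : M} (hy : y ∈ chartDom n x) (i : Fin (n + 1)) :
    coordField x i y =
      (chartTriv n x).symmL ℝ y ((EuclideanSpace.basisFun (Fin (n + 1)) ℝ).toBasis i) :=
  ext_eq hy _

lemma ext_self (x : M) (v : TangentSpace (Mdl n) x) : ext v x = v := extend_apply_self _ v

lemma coordCoeff_coordField {x y : M} (hy : y ∈ chartDom n x) (k i : Fin (n + 1)) :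
    coordCoeff x k y (coordField x i y) = if k = i then 1 else 0 := by
  rw [coordField_eq hy, coordCoeff, ContinuousLinearMap.comp_apply,
    Bundle.Trivialization.continuousLinearMapAt_symmL _ (mem_chartTriv hy)]
  simp

lemma sum_coordCoeff_smul {x y : M} (hy : y ∈ chartDom n x) (v : TangentSpace (Mdl n) y) :
    ∑ i, coordCoeff x i y v • coordField x i y = v := by
  simp only [coordField_eq hy]
  rw [← Bundle.Trivialization.symmL_continuousLinearMapAt (R := ℝ) _ (mem_chartTriv hy) v]
  simp only [coordCoeff, ContinuousLinearMap.comp_apply]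
  rw [Bundle.Trivialization.continuousLinearMapAt_symmL _ (mem_chartTriv hy)]
  set w := (chartTriv n x).continuousLinearMapAt ℝ y v with hw
  conv_rhs => rw [← (EuclideanSpace.basisFun (Fin (n + 1)) ℝ).toBasis.sum_repr w, map_sum]
  refine Finset.sum_congr rfl fun i _ => ?_
  rw [map_smul]
  rfl

/-- The basis of the tangent space at `y` given by the coordinate fields of the preferred chart at
`x`. -/
def coordBasis {x y : M} (hy : y ∈ chartDom n x) : Basis (Fin (n + 1)) ℝ (TangentSpace (Mdl n) y) :=
  Basis.ofEquivFun
    { toFun := fun v i => coordCoeff x i y v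
      invFun := fun c => ∑ i, c i • coordField x i y
      map_add' := fun v w => by ext i; simp
      map_smul' := fun c v => by ext i; simp
      left_inv := fun v => sum_coordCoeff_smul hy v
      right_inv := fun c => by
        ext k
        simp [coordCoeff_coordField hy] }

@[simp] lemma coordBasis_apply {x y : M} (hy : y ∈ chartDom n x) (i : Fin (n + 1)) :
    coordBasis hy i = coordField x i y := by
  simp [coordBasis, Pi.single_apply]

lemma coe_coordBasis {x y : M} (hy : y ∈ chartDom n x) : ⇑(coordBasis hy) = frame x y := by
  ext1 i; exact coordBasis_apply hy i

@[simp] lemma coordBasis_repr {x y : M} (hy : y ∈ chartDom n x) (v : TangentSpace (Mdl n) y)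
    (i : Fin (n + 1)) : (coordBasis hy).repr v i = coordCoeff x i y v := by
  change (coordBasis hy).equivFun v i = _
  simp [coordBasis]

lemma coordField_self (x : M) (i : Fin (n + 1)) :
    coordField (n := n) x i x = stdBasis x i := ext_self x _

lemma frame_self (x : M) : frame (n := n) x x = stdBasis x := by
  ext1 i; exact coordField_self x i

lemma coordBasis_self (x : M) : coordBasis (mem_chartDom (n := n) x) = stdBasis x :=
  Basis.eq_of_apply_eq fun i => by rw [coordBasis_apply, coordField_self]

lemma stdBasis_repr (x : M) (v : TangentSpace (Mdl n) x) (i : Fin (n + 1)) :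
    (stdBasis x).repr v i = coordCoeff x i x v := by
  rw [← coordBasis_self, coordBasis_repr]

lemma ext_smooth {x y : M} (hy : y ∈ chartDom n x) (v : TangentSpace (Mdl n) x) :
    VField.SmoothAt (ext v) y := by
  refine ((chartTriv n x).contMDiffAt_section_iff (mem_chartTriv hy)).2 ?_
  refine (contMDiffAt_const (c := modelVec v)).congr_of_eventuallyEq ?_
  filter_upwards [chartDom_mem_nhds hy] with z hz
  rw [ext_eq hz, ← (chartTriv n x).continuousLinearMapAt_apply_of_mem (R := ℝ) (mem_chartTriv hz),
    Bundle.Trivialization.continuousLinearMapAt_symmL _ (mem_chartTriv hz)]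

lemma coordCoeff_smooth {x y : M} (hy : y ∈ chartDom n x) {X : VField n M} (hX : X.SmoothAt y)
    (i : Fin (n + 1)) : SmoothFnAt n (fun z => coordCoeff x i z (X z)) y := by
  have h1 := ((chartTriv n x).contMDiffAt_section_iff (mem_chartTriv hy)).1 hX
  have h2 := (EuclideanSpace.proj i : EuclideanSpace ℝ (Fin (n + 1)) →L[ℝ] ℝ
    ).contMDiff.contMDiffAt.comp y h1
  refine ContMDiffAt.congr_of_eventuallyEq h2 ?_
  filter_upwards [chartDom_mem_nhds hy] with z hz
  rw [coordCoeff, ContinuousLinearMap.comp_apply,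
    (chartTriv n x).continuousLinearMapAt_apply_of_mem (R := ℝ) (mem_chartTriv hz)]
  rfl

lemma coordCoeff_mdiff {x y : M} (hy : y ∈ chartDom n x) {X : VField n M} (hX : X.DiffAt y)
    (i : Fin (n + 1)) :
    MDifferentiableAt (Mdl n) 𝓘(ℝ) (fun z => coordCoeff x i z (X z)) y := by
  have h1 := ((chartTriv n x).mdifferentiableAt_section_iff (Mdl n) _ (mem_chartTriv hy)).1 hX
  have h2 := (EuclideanSpace.proj i : EuclideanSpace ℝ (Fin (n + 1)) →L[ℝ] ℝ
    ).mdifferentiableAt.comp y h1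
  refine MDifferentiableAt.congr_of_eventuallyEq h2 ?_
  filter_upwards [chartDom_mem_nhds hy] with z hz
  rw [coordCoeff, ContinuousLinearMap.comp_apply,
    (chartTriv n x).continuousLinearMapAt_apply_of_mem (R := ℝ) (mem_chartTriv hz)]
  rfl

/-- The partial derivatives in the preferred chart at `x`. -/
def pd (x : M) (i : Fin (n + 1)) (f : M → ℝ) (y : M) : ℝ :=
  mvfderiv (Mdl n) f y (coordField x i y)

lemma mvfderiv_eq_sum_pd {x y : M} (hy : y ∈ chartDom n x) (f : M → ℝ)
    (v : TangentSpace (Mdl n) y) :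
    mvfderiv (Mdl n) f y v = ∑ i, coordCoeff x i y v * pd x i f y := by
  conv_lhs => rw [← sum_coordCoeff_smul hy v, map_sum]
  simp [pd]

/-- The bridge to calculus in the model space. Derivatives are taken within the closed half space,
so boundary points need no separate treatment. -/
lemma pd_eq_fderivWithin {x y : M} (hy : y ∈ chartDom n x) (i : Fin (n + 1)) {f : M → ℝ}
    (hf : MDifferentiableAt (Mdl n) 𝓘(ℝ) f y) :
    pd x i f y = fderivWithin ℝ (f ∘ (extChartAt (Mdl n) x).symm) (range (Mdl n))
      (extChartAt (Mdl n) x y) ((EuclideanSpace.basisFun (Fin (n + 1)) ℝ).toBasis i) := by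
  have hy' : y ∈ (extChartAt (Mdl n) x).source := by simpa using hy
  have h2 := mvfderiv_comp_mfderivWithin_of_eq (I' := 𝓘(ℝ, EuclideanSpace ℝ (Fin (n + 1))))
    hf (mdifferentiableWithinAt_extChartAt_symm ((extChartAt (Mdl n) x).map_source hy'))
    ((Mdl n).uniqueMDiffOn _ (extChartAt_target_subset_range x ((extChartAt (Mdl n) x).map_source hy')))
    ((extChartAt (Mdl n) x).left_inv hy')
  have h3 : mvfderivWithin 𝓘(ℝ, EuclideanSpace ℝ (Fin (n + 1)))
      (f ∘ (extChartAt (Mdl n) x).symm) (range (Mdl n)) (extChartAt (Mdl n) x y)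
      = fderivWithin ℝ (f ∘ (extChartAt (Mdl n) x).symm) (range (Mdl n))
      (extChartAt (Mdl n) x y) := by
    rw [← mfderivWithin_eq_fderivWithin]; rfl
  rw [← h3, h2, pd, coordField_eq hy, TangentBundle.symmL_trivializationAt hy]
  rfl

lemma contDiffWithinAt_comp_extChartAt_symm {x y : M} (hy : y ∈ chartDom n x) {f : M → ℝ}
    (hf : SmoothFnAt n f y) :
    ContDiffWithinAt ℝ ∞ (f ∘ (extChartAt (Mdl n) x).symm) (range (Mdl n))
      (extChartAt (Mdl n) x y) := by
  have hy' : y ∈ (extChartAt (Mdl n) x).source := by simpa using hy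
  rw [← contMDiffWithinAt_iff_contDiffWithinAt]
  exact ContMDiffAt.comp_contMDiffWithinAt_of_eq hf
    (contMDiffWithinAt_extChartAt_symm_range x ((extChartAt (Mdl n) x).map_source hy'))
    ((extChartAt (Mdl n) x).left_inv hy')

/-- The coordinate representation of a partial derivative. -/
lemma pd_comp_extChartAt_symm {x y : M} (hy : y ∈ chartDom n x) (i : Fin (n + 1)) {f : M → ℝ}
    (hf : SmoothFnAt n f y) :
    (pd x i f) ∘ (extChartAt (Mdl n) x).symm =ᶠ[𝓝[range (Mdl n)] (extChartAt (Mdl n) x y)]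
      fun z => fderivWithin ℝ (f ∘ (extChartAt (Mdl n) x).symm) (range (Mdl n)) z
        ((EuclideanSpace.basisFun (Fin (n + 1)) ℝ).toBasis i) := by
  have hy' : y ∈ (extChartAt (Mdl n) x).source := by simpa using hy
  have h1 : Filter.Tendsto (extChartAt (Mdl n) x).symm
      (𝓝[range (Mdl n)] (extChartAt (Mdl n) x y)) (𝓝 y) := by
    rw [← map_extChartAt_symm_nhdsWithin_range' hy']
    exact Filter.tendsto_map
  filter_upwards [h1.eventually hf.eventually_mdiff, extChartAt_target_mem_nhdsWithin' hy']
    with z hz hz'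
  have := pd_eq_fderivWithin (x := x) (y := (extChartAt (Mdl n) x).symm z)
    (by simpa using (extChartAt (Mdl n) x).map_target hz') i hz
  rwa [(extChartAt (Mdl n) x).right_inv hz'] at this

lemma pd_smooth {x y : M} (hy : y ∈ chartDom n x) (i : Fin (n + 1)) {f : M → ℝ}
    (hf : SmoothFnAt n f y) : SmoothFnAt n (pd x i f) y := by
  have h1 : ContDiffWithinAt ℝ ∞ (fun z => fderivWithin ℝ (f ∘ (extChartAt (Mdl n) x).symm)
      (range (Mdl n)) z ((EuclideanSpace.basisFun (Fin (n + 1)) ℝ).toBasis i)) (range (Mdl n))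
      (extChartAt (Mdl n) x y) :=
    ((contDiffWithinAt_comp_extChartAt_symm hy hf).fderivWithin_right (Mdl n).uniqueDiffOn
      (by simp) (extChartAt_mem_range hy)).clm_apply contDiffWithinAt_const
  have h2 := h1.congr_of_eventuallyEq_of_mem (pd_comp_extChartAt_symm hy i hf)
    (extChartAt_mem_range hy)
  exact (contMDiffAt_iff_source_of_mem_source hy).2 (contMDiffWithinAt_iff_contDiffWithinAt.2 h2)

lemma pd_comm {x y : M} (hy : y ∈ chartDom n x) (i j : Fin (n + 1)) {f : M → ℝ}
    (hf : SmoothFnAt n f y) : pd x i (pd x j f) y = pd x j (pd x i f) y := by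
  have hmem := extChartAt_mem_range hy
  have hd := contDiffWithinAt_comp_extChartAt_symm hy hf
  have hd' : DifferentiableWithinAt ℝ (fderivWithin ℝ
      (f ∘ (extChartAt (Mdl n) x).symm) (range (Mdl n))) (range (Mdl n))
      (extChartAt (Mdl n) x y) :=
    (hd.fderivWithin_right (m := 1) (Mdl n).uniqueDiffOn
      ((show (1 : ℕ∞ω) + 1 = 2 by norm_num) ▸ two_le_infty) hmem).differentiableWithinAt
      (by simp)
  have key : ∀ i j, pd x i (pd x j f) y = fderivWithin ℝ (fderivWithin ℝ
      (f ∘ (extChartAt (Mdl n) x).symm) (range (Mdl n))) (range (Mdl n)) (extChartAt (Mdl n) x y)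
      ((EuclideanSpace.basisFun (Fin (n + 1)) ℝ).toBasis i)
      ((EuclideanSpace.basisFun (Fin (n + 1)) ℝ).toBasis j) := by
    intro i j
    rw [pd_eq_fderivWithin hy i (pd_smooth hy j hf).mdiff,
      (pd_comp_extChartAt_symm hy j hf).fderivWithin_eq_of_mem hmem,
      fderivWithin_clm_apply ((Mdl n).uniqueDiffOn _ hmem) hd' (differentiableWithinAt_const _)]
    simp
  rw [key, key]
  -- Second derivatives within the half space are symmetric at its boundary as well, because it lies
  -- in the closure of its interior.
  exact (hd.isSymmSndFDerivWithinAt (by rw [minSmoothness_of_isRCLikeNormedField]; exact two_le_infty) (Mdl n).uniqueDiffOn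
    ((Mdl n).range_subset_closure_interior hmem) hmem) _ _

/-- Coordinate fields are pullbacks of constant fields under the chart, and the Lie bracket commutes
with pullback. -/
lemma mlieBracket_coordField {x y : M} (hy : y ∈ chartDom n x) (i j : Fin (n + 1)) :
    VectorField.mlieBracket (Mdl n) (coordField x i) (coordField x j) y = 0 := by
  have : IsManifold (Mdl n) (minSmoothness ℝ 2) M := by
    rw [minSmoothness_of_isRCLikeNormedField]
    infer_instance
  have : IsManifold 𝓘(ℝ, EuclideanSpace ℝ (Fin (n + 1))) (minSmoothness ℝ 2)
      (EuclideanSpace ℝ (Fin (n + 1))) := by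
    rw [minSmoothness_of_isRCLikeNormedField]
    infer_instance
  set V : Fin (n + 1) → Π z : EuclideanSpace ℝ (Fin (n + 1)),
      TangentSpace 𝓘(ℝ, EuclideanSpace ℝ (Fin (n + 1))) z := fun i _ =>
    (EuclideanSpace.basisFun (Fin (n + 1)) ℝ).toBasis i with hV
  have hVd : ∀ i z, MDifferentiableAt 𝓘(ℝ, EuclideanSpace ℝ (Fin (n + 1)))
      (𝓘(ℝ, EuclideanSpace ℝ (Fin (n + 1))).tangent) (fun z => (⟨z, V i z⟩ :
        TangentBundle 𝓘(ℝ, EuclideanSpace ℝ (Fin (n + 1))) (EuclideanSpace ℝ (Fin (n + 1))))) z :=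
    fun i z => ContMDiffAt.mdifferentiableAt (n := 1)
      (contMDiffAt_vectorSpace_iff_contDiffAt.2 contDiffAt_const) (by simp)
  have h := fun i => show (coordField x i) =ᶠ[𝓝 y] VectorField.mpullback (Mdl n)
      𝓘(ℝ, EuclideanSpace ℝ (Fin (n + 1))) (extChartAt (Mdl n) x) (V i) by
    filter_upwards [chartDom_mem_nhds hy] with z hz
    rw [VectorField.mpullback_apply]
    refine ((isInvertible_mfderiv_extChartAt (by simpa using hz)).inverse_apply_eq.2 ?_).symm
    rw [← TangentBundle.continuousLinearMapAt_trivializationAt hz, coordField_eq hz]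
    exact (Bundle.Trivialization.continuousLinearMapAt_symmL _ (mem_chartTriv hz) _).symm
  rw [Filter.EventuallyEq.mlieBracket_vectorField_eq (h i) (h j),
    ← VectorField.mpullback_mlieBracket (n := ∞) (hVd i _) (hVd j _)
      (contMDiffAt_extChartAt' hy) (by rw [minSmoothness_of_isRCLikeNormedField]; exact two_le_infty)]
  rw [VectorField.mpullback_apply, ← VectorField.mlieBracketWithin_univ,
    VectorField.mlieBracketWithin_eq_lieBracketWithin]
  simp only [VectorField.lieBracketWithin, V]
  simp only [fderivWithin_const_apply, zero_apply, sub_self]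
  exact map_zero _

end ProjComp

/-! ### Connections, curvature and Ricci tensor in coordinates. -/

namespace ProjComp

variable {n : ℕ} {M : Type*} [TopologicalSpace M] [ChartedSpace (EuclideanHalfSpace (n + 1)) M]

lemma mvfderiv_congr {f g : M → ℝ} {y : M} (h : f =ᶠ[𝓝 y] g) :
    mvfderiv (Mdl n) f y = mvfderiv (Mdl n) g y := by
  simp only [mvfderiv]
  rw [h.mfderiv_eq]
  rfl

lemma mdiff_sum {ι : Type*} (s : Finset ι) {f : ι → M → ℝ} {y : M}
    (hf : ∀ j, MDifferentiableAt (Mdl n) 𝓘(ℝ) (f j) y) :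
    MDifferentiableAt (Mdl n) 𝓘(ℝ) (fun z => ∑ j ∈ s, f j z) y := by
  classical
  induction s using Finset.induction_on with
  | empty =>
    simp only [Finset.sum_empty]
    exact mdifferentiableAt_const
  | insert a s ha ih =>
    simp only [Finset.sum_insert ha]
    exact (hf a).add ih

lemma curvature_swap (D : Conn n M) (X Y Z : VField n M) (y : M) :
    curvature D X Y Z y = - curvature D Y X Z y := by
  simp only [curvature]
  rw [VectorField.mlieBracket_swap_apply (V := X), map_neg]
  abel

variable [IsManifold (Mdl n) ∞ M] {D : Conn n M} {U : Set M}

lemma VField.SmoothAt.isSmoothOn {X : VField n M} {V : Set M} (h : ∀ y ∈ V, X.SmoothAt y) :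
    X.IsSmoothOn V := fun y hy => (h y hy).contMDiffWithinAt

lemma VField.IsSmoothOn.smoothAt {X : VField n M} {V : Set M} (h : X.IsSmoothOn V)
    (hV : IsOpen V) {y : M} (hy : y ∈ V) : X.SmoothAt y :=
  (h y hy).contMDiffAt (hV.mem_nhds hy)

lemma coordField_smoothOn (x : M) (i : Fin (n + 1)) :
    (coordField x i).IsSmoothOn (chartDom n x) :=
  VField.SmoothAt.isSmoothOn fun _ hy => ext_smooth hy _

lemma coordField_smoothAt {x y : M} (hy : y ∈ chartDom n x) (i : Fin (n + 1)) :
    (coordField x i).SmoothAt y := ext_smooth hy _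

/-- The covariant derivative of a field as a section of the endomorphism bundle. -/
lemma IsAffineConnectionOn.smoothAt_hom (hD : IsAffineConnectionOn D U) {V : Set M}
    (hV : IsOpen V) (hVU : V ⊆ U) {Y : VField n M} (hY : Y.IsSmoothOn V) {y : M} (hy : y ∈ V) :
    ContMDiffAt (Mdl n) ((Mdl n).prod 𝓘(ℝ, EuclideanSpace ℝ (Fin (n + 1)) →L[ℝ]
        EuclideanSpace ℝ (Fin (n + 1)))) ∞
      (fun z => Bundle.TotalSpace.mk' (EuclideanSpace ℝ (Fin (n + 1)) →L[ℝ]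
        EuclideanSpace ℝ (Fin (n + 1)))
        (E := fun z : M => TangentSpace (Mdl n) z →L[ℝ] TangentSpace (Mdl n) z) z (D Y z)) y :=
  ((hD.smooth V hV hVU).contMDiff hY y hy).contMDiffAt (hV.mem_nhds hy)

lemma IsAffineConnectionOn.smoothAt_apply (hD : IsAffineConnectionOn D U) {V : Set M}
    (hV : IsOpen V) (hVU : V ⊆ U) {Y : VField n M} (hY : Y.IsSmoothOn V) {y : M} (hy : y ∈ V)
    {X : VField n M} (hX : X.SmoothAt y) : VField.SmoothAt (fun z => D Y z (X z)) y :=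
  ContMDiffAt.clm_bundle_apply (hD.smoothAt_hom hV hVU hY hy) hX

lemma IsAffineConnectionOn.diffAt_apply (hD : IsAffineConnectionOn D U) {V : Set M}
    (hV : IsOpen V) (hVU : V ⊆ U) {Y : VField n M} (hY : Y.IsSmoothOn V) {y : M} (hy : y ∈ V)
    {X : VField n M} (hX : X.DiffAt y) : VField.DiffAt (fun z => D Y z (X z)) y :=
  MDifferentiableAt.clm_bundle_apply
    ((hD.smoothAt_hom hV hVU hY hy).mdifferentiableAt (by simp)) hX

/-- The connection coefficients in the preferred chart at `x`. -/
def christoffel (D : Conn n M) (x : M) (k i j : Fin (n + 1)) (y : M) : ℝ :=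
  coordCoeff x k y (D (coordField x j) y (coordField x i y))

lemma IsAffineConnectionOn.christoffel_smooth (hD : IsAffineConnectionOn D U) (hU : IsOpen U)
    {x y : M} (hy : y ∈ chartDom n x) (hyU : y ∈ U) (k i j : Fin (n + 1)) :
    SmoothFnAt n (christoffel D x k i j) y :=
  coordCoeff_smooth hy (hD.smoothAt_apply
    (hU.inter (chartAt (EuclideanHalfSpace (n + 1)) x).open_source) inter_subset_left
    ((coordField_smoothOn x j).mono inter_subset_right) ⟨hyU, hy⟩ (coordField_smoothAt hy i)) k

lemma IsAffineConnectionOn.christoffel_symm (hD : IsAffineConnectionOn D U)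
    {x y : M} (hy : y ∈ chartDom n x) (hyU : y ∈ U) (k i j : Fin (n + 1)) :
    christoffel D x k i j y = christoffel D x k j i y := by
  have h := hD.torsion_free (coordField x i) (coordField x j) y hyU
    (coordField_smoothAt hy i).diffAt (coordField_smoothAt hy j).diffAt
  rw [mlieBracket_coordField hy, sub_eq_zero] at h
  rw [christoffel, h, christoffel]

lemma IsAffineConnectionOn.congr (hD : IsAffineConnectionOn D U) (hU : IsOpen U) {y : M}
    (hyU : y ∈ U) {Y Y' : VField n M} (hY : Y.DiffAt y) (hY' : Y'.DiffAt y) (h : Y =ᶠ[𝓝 y] Y') :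
    D Y y = D Y' y :=
  hD.covariant.congr_of_eventuallyEq hY hY' (hU.mem_nhds hyU) h

lemma IsAffineConnectionOn.sum (hD : IsAffineConnectionOn D U) {y : M}
    (hyU : y ∈ U) {ι : Type*} (s : Finset ι) {Y : ι → VField n M} (hY : ∀ i, (Y i).DiffAt y) :
    D (fun z => ∑ i ∈ s, Y i z) y = ∑ i ∈ s, D (Y i) y := by
  classical
  induction s using Finset.induction_on with
  | empty =>
    simp only [Finset.sum_empty]
    exact hD.covariant.zero hyU
  | insert a s ha ih =>
    simp only [Finset.sum_insert ha]
    rw [← ih]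
    exact hD.covariant.add (hY a) (MDifferentiableAt.sum_section fun i _ => hY i) hyU

/-- The coordinate expression of a covariant derivative. -/
lemma IsAffineConnectionOn.coordCoeff_apply (hD : IsAffineConnectionOn D U) (hU : IsOpen U)
    {x y : M} (hy : y ∈ chartDom n x) (hyU : y ∈ U) {Y : VField n M} (hY : Y.DiffAt y)
    (v : TangentSpace (Mdl n) y) (k : Fin (n + 1)) :
    coordCoeff x k y (D Y y v) = mvfderiv (Mdl n) (fun z => coordCoeff x k z (Y z)) y v
      + ∑ j, coordCoeff x j y (Y y) * coordCoeff x k y (D (coordField x j) y v) := by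
  have hc := fun j => coordCoeff_mdiff hy hY j
  have he := fun j => (coordField_smoothAt hy j).diffAt
  have hce : ∀ j, VField.DiffAt ((fun z => coordCoeff x j z (Y z)) • coordField x j) y :=
    fun j => MDifferentiableAt.smul_section (hc j) (he j)
  have h1 : D Y y = ∑ j, D ((fun z => coordCoeff x j z (Y z)) • coordField x j) y := by
    rw [← hD.sum hyU _ hce]
    refine hD.congr hU hyU hY (MDifferentiableAt.sum_section fun i _ => hce i) ?_
    filter_upwards [chartDom_mem_nhds hy] with z hz
    exact (sum_coordCoeff_smul hz (Y z)).symm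
  rw [h1]
  simp only [hD.covariant.leibniz (he _) (hc _) hyU]
  rw [sum_apply, map_sum]
  simp only [add_apply, map_add, smul_apply, map_smul,
    ContinuousLinearMap.smulRight_apply, smul_eq_mul, coordCoeff_coordField hy,
    Finset.sum_add_distrib]
  simp [add_comm]

/-- The coordinate expression of the curvature tensor. -/
def riemCoord (D : Conn n M) (x : M) (m i j l : Fin (n + 1)) (y : M) : ℝ :=
  pd x i (christoffel D x m j l) y - pd x j (christoffel D x m i l) y
    + ∑ k, (christoffel D x k j l y * christoffel D x m i k y
      - christoffel D x k i l y * christoffel D x m j k y)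

/-- The coordinate expression of the Ricci tensor. -/
def ricciCoord (D : Conn n M) (x : M) (j l : Fin (n + 1)) (y : M) : ℝ :=
  ∑ i, riemCoord D x i i j l y

lemma pd_congr (x : M) (i : Fin (n + 1)) {f g : M → ℝ} {y : M} (h : f =ᶠ[𝓝 y] g) :
    pd x i f y = pd x i g y := by
  rw [pd, mvfderiv_congr h, pd]

lemma pd_add (x : M) (i : Fin (n + 1)) {f g : M → ℝ} {y : M}
    (hf : MDifferentiableAt (Mdl n) 𝓘(ℝ) f y) (hg : MDifferentiableAt (Mdl n) 𝓘(ℝ) g y) :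
    pd x i (fun z => f z + g z) y = pd x i f y + pd x i g y := by
  change mvfderiv (Mdl n) (f + g) y _ = _
  rw [mvfderiv_add hf hg]
  rfl

lemma pd_sub (x : M) (i : Fin (n + 1)) {f g : M → ℝ} {y : M}
    (hf : MDifferentiableAt (Mdl n) 𝓘(ℝ) f y) (hg : MDifferentiableAt (Mdl n) 𝓘(ℝ) g y) :
    pd x i (fun z => f z - g z) y = pd x i f y - pd x i g y := by
  change mvfderiv (Mdl n) (f - g) y _ = _
  rw [mvfderiv_sub hf hg]
  rfl

lemma pd_mul (x : M) (i : Fin (n + 1)) {f g : M → ℝ} {y : M}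
    (hf : MDifferentiableAt (Mdl n) 𝓘(ℝ) f y) (hg : MDifferentiableAt (Mdl n) 𝓘(ℝ) g y) :
    pd x i (fun z => f z * g z) y = f y * pd x i g y + g y * pd x i f y := by
  change mvfderiv (Mdl n) (f * g) y _ = _
  rw [mvfderiv_mul hf hg]
  simp [pd]

lemma pd_const_mul (x : M) (i : Fin (n + 1)) (c : ℝ) {f : M → ℝ} {y : M}
    (hf : MDifferentiableAt (Mdl n) 𝓘(ℝ) f y) :
    pd x i (fun z => c * f z) y = c * pd x i f y := by
  rw [pd_mul x i mdifferentiableAt_const hf]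
  simp [pd, mvfderiv_const]

lemma pd_sum (x : M) (i : Fin (n + 1)) {ι : Type*} (s : Finset ι) {f : ι → M → ℝ} {y : M}
    (hf : ∀ j, MDifferentiableAt (Mdl n) 𝓘(ℝ) (f j) y) :
    pd x i (fun z => ∑ j ∈ s, f j z) y = ∑ j ∈ s, pd x i (f j) y := by
  classical
  induction s using Finset.induction_on with
  | empty => simp [pd, mvfderiv_const]
  | insert a s ha ih =>
    simp only [Finset.sum_insert ha]
    rw [pd_add x i (hf a) (mdiff_sum s hf), ih]

/-- The derivative terms of `f` produced by the Leibniz rule cancel against those of the bracket.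
`Z` is differentiated twice and must be smooth near the point, whereas differentiability of the slot
`X` at the point suffices. -/
lemma IsAffineConnectionOn.curvature_tensorialAt (hD : IsAffineConnectionOn D U) {V : Set M}
    (hV : IsOpen V) (hVU : V ⊆ U) {Y Z : VField n M} (hZ : Z.IsSmoothOn V) {y : M} (hy : y ∈ V) :
    TensorialAt (Mdl n) (EuclideanSpace ℝ (Fin (n + 1))) (fun X => curvature D X Y Z y) y where
  smul := by
    intro f X hf hX
    have h1 : (fun z => D Z z ((f • X) z)) = f • (fun z => D Z z (X z)) := by
      ext1 z
      exact (D Z z).map_smul (f z) (X z)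
    have h2 := hD.covariant.leibniz (hD.diffAt_apply hV hVU hZ hy hX) hf (hVU hy)
    simp only [curvature]
    rw [h1, h2, VectorField.mlieBracket_smul_left hf hX]
    have h3 : D (fun z => D Z z (Y z)) y ((f • X) y) = f y • D (fun z => D Z z (Y z)) y (X y) :=
      ContinuousLinearMap.map_smul _ (f y) (X y)
    rw [h3, add_apply, smul_apply, ContinuousLinearMap.smulRight_apply, map_add, map_smul, map_smul,
      smul_sub, smul_sub, neg_smul, ← sub_sub, sub_add_eq_sub_sub, sub_neg_eq_add]
    abel
  add := by
    intro X X' hX hX'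
    have h1 : (fun z => D Z z ((X + X') z)) = (fun z => D Z z (X z)) + fun z => D Z z (X' z) := by
      ext1 z
      exact (D Z z).map_add (X z) (X' z)
    simp only [curvature]
    rw [h1, hD.covariant.add (hD.diffAt_apply hV hVU hZ hy hX) (hD.diffAt_apply hV hVU hZ hy hX')
      (hVU hy), VectorField.mlieBracket_add_left hX hX']
    have h3 : D (fun z => D Z z (Y z)) y ((X + X') y) = D (fun z => D Z z (Y z)) y (X y)
        + D (fun z => D Z z (Y z)) y (X' y) :=
      ContinuousLinearMap.map_add _ (X y) (X' y)
    rw [h3, add_apply, map_add]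
    abel

lemma IsAffineConnectionOn.curvature_tensorialAt_right (hD : IsAffineConnectionOn D U) {V : Set M}
    (hV : IsOpen V) (hVU : V ⊆ U) {X Z : VField n M} (hZ : Z.IsSmoothOn V) {y : M} (hy : y ∈ V) :
    TensorialAt (Mdl n) (EuclideanSpace ℝ (Fin (n + 1))) (fun Y => curvature D X Y Z y) y where
  smul := by
    intro f Y hf hY
    rw [curvature_swap, (hD.curvature_tensorialAt hV hVU hZ hy).smul hf hY, curvature_swap,
      smul_neg, neg_neg]
  add := by
    intro Y Y' hY hY'
    rw [curvature_swap, (hD.curvature_tensorialAt hV hVU hZ hy).add hY hY', curvature_swap,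
      curvature_swap D X Y', neg_add]
    abel

/-- This takes the place of tensoriality in `Z`. After antisymmetrizing in `i` and `j`, second
derivatives of the coefficients of `Z` cancel by `pd_comm`, and the first derivative terms cancel
because together they are symmetric. -/
lemma IsAffineConnectionOn.coordCoeff_curvature (hD : IsAffineConnectionOn D U) (hU : IsOpen U)
    {x y : M} (hy : y ∈ chartDom n x) (hyU : y ∈ U) {V : Set M} (hV : IsOpen V) (hVU : V ⊆ U)
    {Z : VField n M} (hZ : Z.IsSmoothOn V) (hyV : y ∈ V) (m i j : Fin (n + 1)) :
    coordCoeff x m y (curvature D (coordField x i) (coordField x j) Z y) =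
      ∑ l, coordCoeff x l y (Z y) * riemCoord D x m i j l y := by
  have hZc : ∀ l, SmoothFnAt n (fun z => coordCoeff x l z (Z z)) y := fun l =>
    coordCoeff_smooth hy (hZ.smoothAt hV hyV) l
  have hΓ : ∀ k i j, SmoothFnAt n (christoffel D x k i j) y := fun k i j =>
    hD.christoffel_smooth hU hy hyU k i j
  have h1 : ∀ j k, (fun z => coordCoeff x k z (D Z z (coordField x j z))) =ᶠ[𝓝 y] fun z =>
      pd x j (fun z => coordCoeff x k z (Z z)) z
        + ∑ l, coordCoeff x l z (Z z) * christoffel D x k j l z := by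
    intro j k
    filter_upwards [chartDom_mem_nhds hy, hV.mem_nhds hyV] with z hz hzV
    exact hD.coordCoeff_apply hU hz (hVU hzV) (hZ.smoothAt hV hzV).diffAt _ k
  have h2 : ∀ i j, coordCoeff x m y (D (fun z => D Z z (coordField x j z)) y (coordField x i y)) =
      pd x i (pd x j (fun z => coordCoeff x m z (Z z))) y
        + ∑ l, (coordCoeff x l y (Z y) * pd x i (christoffel D x m j l) y
          + christoffel D x m j l y * pd x i (fun z => coordCoeff x l z (Z z)) y)
        + ∑ k, (pd x j (fun z => coordCoeff x k z (Z z)) y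
          + ∑ l, coordCoeff x l y (Z y) * christoffel D x k j l y) * christoffel D x m i k y := by
    intro i j
    rw [hD.coordCoeff_apply hU hy hyU (hD.diffAt_apply hV hVU hZ hyV (coordField_smoothAt hy j).diffAt)]
    congr 1
    · have hp : ∀ l, MDifferentiableAt (Mdl n) 𝓘(ℝ)
          (fun z => coordCoeff x l z (Z z) * christoffel D x m j l z) y :=
        fun l => (hZc l).mdiff.mul (hΓ m j l).mdiff
      change pd x i _ y = _
      rw [pd_congr x i (h1 j m), pd_add x i (pd_smooth hy j (hZc m)).mdiff (mdiff_sum _ hp),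
        pd_sum x i _ hp]
      simp only [pd_mul x i (hZc _).mdiff (hΓ m j _).mdiff]
    · refine Finset.sum_congr rfl fun k _ => ?_
      rw [(h1 j k).eq_of_nhds]
      rfl
  simp only [curvature, map_sub]
  rw [mlieBracket_coordField hy, map_zero, map_zero, sub_zero, h2, h2, pd_comm hy i j (hZc m)]
  simp only [riemCoord, mul_add, add_mul, mul_sub, Finset.sum_add_distrib, Finset.sum_sub_distrib,
    Finset.mul_sum, Finset.sum_mul]
  rw [Finset.sum_comm (f := fun k l => coordCoeff x l y (Z y) * christoffel D x k j l y *
      christoffel D x m i k y),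
    Finset.sum_comm (f := fun k l => coordCoeff x l y (Z y) * christoffel D x k i l y *
      christoffel D x m j k y)]
  simp only [mul_assoc, mul_comm (christoffel D x m _ _ y)]
  ring

/-- Basis independence of the trace. It moves quantities defined by the preferred chart at the point
itself to the frame of a fixed chart nearby. -/
lemma sum_repr_eq_trace {ι ι' W : Type*} [Fintype ι] [Fintype ι'] [DecidableEq ι] [DecidableEq ι']
    [AddCommGroup W] [Module ℝ W]
    (b : Basis ι ℝ W) (b' : Basis ι' ℝ W) (φ : W →ₗ[ℝ] W) :
    ∑ i, b.repr (φ (b i)) i = ∑ i, b'.repr (φ (b' i)) i := by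
  have h1 := LinearMap.trace_eq_matrix_trace ℝ b φ
  rw [LinearMap.trace_eq_matrix_trace ℝ b' φ] at h1
  simpa [Matrix.trace, LinearMap.toMatrix_apply] using h1.symm

/-- The Ricci tensor in coordinates. -/
theorem IsAffineConnectionOn.ricci_eq (hD : IsAffineConnectionOn D U) (hU : IsOpen U)
    {x y : M} (hy : y ∈ chartDom n x) (hyU : y ∈ U) (v w : TangentSpace (Mdl n) y) :
    ricci D y v w = ∑ j, ∑ l, coordCoeff x j y v * coordCoeff x l y w * ricciCoord D x j l y := by
  have hV : IsOpen (U ∩ chartDom n y) :=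
    hU.inter (chartAt (EuclideanHalfSpace (n + 1)) y).open_source
  have hVU : U ∩ chartDom n y ⊆ U := inter_subset_left
  have hZ : VField.IsSmoothOn (ext w) (U ∩ chartDom n y) :=
    VField.SmoothAt.isSmoothOn fun z hz => ext_smooth hz.2 w
  have hyV : y ∈ U ∩ chartDom n y := ⟨hyU, mem_chartDom y⟩
  have hext : ∀ v : TangentSpace (Mdl n) y, VField.DiffAt (ext v) y :=
    fun v => (ext_smooth (mem_chartDom y) v).diffAt
  set Φ := TensorialAt.mkHom₂ (fun X Y => curvature D X Y (ext w) y) y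
    (fun _ _ => hD.curvature_tensorialAt hV hVU hZ hyV)
    (fun _ _ => hD.curvature_tensorialAt_right hV hVU hZ hyV) with hΦ
  have hΦa : ∀ X Y : VField n M, X.DiffAt y → Y.DiffAt y →
      Φ (X y) (Y y) = curvature D X Y (ext w) y :=
    fun X Y hX hY => TensorialAt.mkHom₂_apply _ _ hX hY
  -- The definition of `ricci` uses the frame of the chart at `y`. As the trace of this endomorphism
  -- it can be computed in the frame of the chart at `x`.
  let φ : TangentSpace (Mdl n) y →ₗ[ℝ] TangentSpace (Mdl n) y :=
    { toFun := fun u => Φ u v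
      map_add' := fun u u' => by rw [map_add, add_apply]
      map_smul' := fun c u => by rw [map_smul, smul_apply]; rfl }
  have h1 : ricci D y v w = ∑ i, (stdBasis y).repr (φ (stdBasis y i)) i := by
    refine Finset.sum_congr rfl fun i _ => ?_
    rw [← hΦa _ _ (hext _) (hext _), ext_self, ext_self]
    rfl
  have h2 := sum_repr_eq_trace (stdBasis y) (coordBasis hy) φ
  rw [h1]
  refine h2.trans ?_
  simp only [coordBasis_repr, coordBasis_apply, φ, LinearMap.coe_mk, AddHom.coe_mk]
  have h3 : ∀ i, coordCoeff x i y (Φ (coordField x i y) v) =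
      ∑ j, ∑ l, coordCoeff x j y v * (coordCoeff x l y w * riemCoord D x i i j l y) := by
    intro i
    conv_lhs => rw [← sum_coordCoeff_smul hy v]
    rw [map_sum, map_sum]
    refine Finset.sum_congr rfl fun j _ => ?_
    rw [map_smul, map_smul, hΦa _ _ (coordField_smoothAt hy i).diffAt
      (coordField_smoothAt hy j).diffAt, hD.coordCoeff_curvature hU hy hyU hV hVU hZ hyV, ext_self,
      smul_eq_mul, Finset.mul_sum]
  simp only [h3]
  rw [Finset.sum_comm]
  refine Finset.sum_congr rfl fun j _ => ?_
  rw [Finset.sum_comm]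
  refine Finset.sum_congr rfl fun l _ => ?_
  simp only [ricciCoord, Finset.mul_sum, mul_assoc]

lemma IsAffineConnectionOn.ricci_coordField (hD : IsAffineConnectionOn D U) (hU : IsOpen U)
    {x y : M} (hy : y ∈ chartDom n x) (hyU : y ∈ U) (j l : Fin (n + 1)) :
    ricci D y (coordField x j y) (coordField x l y) = ricciCoord D x j l y := by
  rw [hD.ricci_eq hU hy hyU]
  simp [coordCoeff_coordField hy]

lemma IsAffineConnectionOn.ricciCoord_smooth (hD : IsAffineConnectionOn D U) (hU : IsOpen U)
    {x y : M} (hy : y ∈ chartDom n x) (hyU : y ∈ U) (j l : Fin (n + 1)) :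
    SmoothFnAt n (ricciCoord D x j l) y := by
  have hΓ : ∀ k i j, SmoothFnAt n (christoffel D x k i j) y := fun k i j =>
    hD.christoffel_smooth hU hy hyU k i j
  refine contMDiffAt_finsetSum fun i _ => ?_
  refine ((pd_smooth hy i (hΓ _ _ _)).sub (pd_smooth hy j (hΓ _ _ _))).add
    (contMDiffAt_finsetSum fun k _ => ?_)
  exact ((hΓ _ _ _).mul (hΓ _ _ _)).sub ((hΓ _ _ _).mul (hΓ _ _ _))

end ProjComp

/-! ### Densities and their covariant derivatives in coordinates. -/

namespace ProjComp

lemma Density.eq_zero_iff {m : ℕ} {r : ℝ} {V : Type*} [AddCommGroup V] [Module ℝ V]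
    (φ : Density m r V) (b : Basis (Fin m) ℝ V) : φ = 0 ↔ φ.1 b = 0 := by
  refine ⟨fun h => by rw [h]; rfl, fun h => Subtype.ext (funext fun v => ?_)⟩
  rw [φ.2 b v, h, mul_zero]
  rfl

/-- Away from zero `|t| ^ r` is `exp (r log t)` for either sign of `t`, since `Real.log` is even. -/
lemma hasDerivAt_abs_rpow' (r : ℝ) {t : ℝ} (ht : t ≠ 0) :
    HasDerivAt (fun t : ℝ => |t| ^ r) (r * |t| ^ r / t) t := by
  have h : (fun t : ℝ => |t| ^ r) =ᶠ[𝓝 t] fun t => Real.exp (Real.log t * r) := by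
    filter_upwards [isOpen_ne.mem_nhds ht] with u hu
    rw [Real.rpow_def_of_pos (abs_pos.2 hu), Real.log_abs]
  refine HasDerivAt.congr_of_eventuallyEq ?_ h
  rw [h.eq_of_nhds]
  exact (((Real.hasDerivAt_log ht).mul_const r).exp).congr_deriv (by ring)

lemma contDiffAt_abs_rpow (r : ℝ) {t : ℝ} (ht : t ≠ 0) :
    ContDiffAt ℝ ∞ (fun t : ℝ => |t| ^ r) t := by
  have h : (fun t : ℝ => |t| ^ r) =ᶠ[𝓝 t] fun t => Real.exp (Real.log t * r) := by
    filter_upwards [isOpen_ne.mem_nhds ht] with u hu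
    rw [Real.rpow_def_of_pos (abs_pos.2 hu), Real.log_abs]
  exact ((((Real.contDiffAt_log).2 ht).mul contDiffAt_const).exp).congr_of_eventuallyEq h

variable {n : ℕ} {M : Type*} [TopologicalSpace M] [ChartedSpace (EuclideanHalfSpace (n + 1)) M]

lemma mvfderiv_comp_real {F : ℝ → ℝ} {F' : ℝ} {g : M → ℝ} {y : M} (hF : HasDerivAt F F' (g y))
    (hg : MDifferentiableAt (Mdl n) 𝓘(ℝ) g y) (v : TangentSpace (Mdl n) y) :
    mvfderiv (Mdl n) (fun z => F (g z)) y v = F' * mvfderiv (Mdl n) g y v := by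
  have h := (hF.hasFDerivAt.hasMFDerivAt).comp y hg.hasMFDerivAt
  change mfderiv (Mdl n) 𝓘(ℝ) (F ∘ g) y v = _
  rw [h.mfderiv]
  change (ContinuousLinearMap.toSpanSingleton ℝ F') (mvfderiv (Mdl n) g y v) = _
  rw [ContinuousLinearMap.toSpanSingleton_apply, smul_eq_mul, mul_comm]

lemma mdiff_prod {ι : Type*} (s : Finset ι) {f : ι → M → ℝ} {y : M}
    (hf : ∀ j, MDifferentiableAt (Mdl n) 𝓘(ℝ) (f j) y) :
    MDifferentiableAt (Mdl n) 𝓘(ℝ) (fun z => ∏ j ∈ s, f j z) y := by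
  classical
  induction s using Finset.induction_on with
  | empty =>
    simp only [Finset.prod_empty]
    exact mdifferentiableAt_const
  | insert a s ha ih =>
    simp only [Finset.prod_insert ha]
    exact (hf a).mul ih

lemma mvfderiv_sum {ι : Type*} (s : Finset ι) {f : ι → M → ℝ} {y : M}
    (hf : ∀ j, MDifferentiableAt (Mdl n) 𝓘(ℝ) (f j) y) (v : TangentSpace (Mdl n) y) :
    mvfderiv (Mdl n) (fun z => ∑ j ∈ s, f j z) y v = ∑ j ∈ s, mvfderiv (Mdl n) (f j) y v := by
  classical
  induction s using Finset.induction_on with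
  | empty => simp [mvfderiv_const]
  | insert a s ha ih =>
    simp only [Finset.sum_insert ha]
    rw [← ih]
    exact congrArg (fun L => L v) (mvfderiv_add (hf a) (mdiff_sum s hf))

lemma mvfderiv_mul_apply {f g : M → ℝ} {y : M}
    (hf : MDifferentiableAt (Mdl n) 𝓘(ℝ) f y) (hg : MDifferentiableAt (Mdl n) 𝓘(ℝ) g y)
    (v : TangentSpace (Mdl n) y) : mvfderiv (Mdl n) (fun z => f z * g z) y v =
      f y * mvfderiv (Mdl n) g y v + g y * mvfderiv (Mdl n) f y v :=
  congrArg (fun L => L v) (mvfderiv_mul hf hg)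

/-- The product rule is written with `Function.update` so that, summed over permutations, it becomes
a sum of determinants with one replaced column. -/
lemma mvfderiv_prod {ι : Type*} [DecidableEq ι] (s : Finset ι) {f : ι → M → ℝ} {y : M}
    (hf : ∀ j, MDifferentiableAt (Mdl n) 𝓘(ℝ) (f j) y) (v : TangentSpace (Mdl n) y) :
    mvfderiv (Mdl n) (fun z => ∏ j ∈ s, f j z) y v =
      ∑ j ∈ s, ∏ i ∈ s, Function.update (fun i => f i y) j (mvfderiv (Mdl n) (f j) y v) i := by
  induction s using Finset.induction_on with
  | empty => simp [mvfderiv_const]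
  | insert a s ha ih =>
    simp only [Finset.prod_insert ha]
    rw [mvfderiv_mul_apply (hf a) (mdiff_prod s hf), ih, Finset.sum_insert ha, add_comm]
    congr 1
    · rw [Function.update_self, Finset.prod_update_of_notMem ha, mul_comm]
    · rw [Finset.mul_sum]
      refine Finset.sum_congr rfl fun j hj => ?_
      rw [Function.update_of_ne (ne_of_mem_of_not_mem hj ha).symm]

/-- Jacobi's formula for the derivative of a determinant. -/
lemma mvfderiv_det {m : ℕ} {A : M → Matrix (Fin m) (Fin m) ℝ} {y : M}
    (hA : ∀ i j, MDifferentiableAt (Mdl n) 𝓘(ℝ) (fun z => A z i j) y)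
    (v : TangentSpace (Mdl n) y) :
    MDifferentiableAt (Mdl n) 𝓘(ℝ) (fun z => (A z).det) y ∧
    mvfderiv (Mdl n) (fun z => (A z).det) y v =
      ∑ j, ((A y).updateCol j fun i => mvfderiv (Mdl n) (fun z => A z i j) y v).det := by
  have hp : ∀ σ : Equiv.Perm (Fin m), MDifferentiableAt (Mdl n) 𝓘(ℝ)
      (fun z => ∏ i, A z (σ i) i) y := fun σ => mdiff_prod _ fun i => hA (σ i) i
  have hp' : ∀ σ : Equiv.Perm (Fin m), MDifferentiableAt (Mdl n) 𝓘(ℝ)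
      (fun z => ((Equiv.Perm.sign σ : ℤ) : ℝ) * ∏ i, A z (σ i) i) y :=
    fun σ => mdifferentiableAt_const.mul (hp σ)
  simp only [Matrix.det_apply']
  refine ⟨mdiff_sum _ hp', ?_⟩
  rw [mvfderiv_sum _ hp', Finset.sum_comm]
  refine Finset.sum_congr rfl fun σ _ => ?_
  rw [mvfderiv_mul_apply mdifferentiableAt_const (hp σ), mvfderiv_const,
    mvfderiv_prod _ fun i => hA (σ i) i, Finset.mul_sum]
  simp only [zero_apply, mul_zero, add_zero]
  refine Finset.sum_congr rfl fun j _ => congrArg _ (Finset.prod_congr rfl fun i _ => ?_)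
  rw [Matrix.updateCol_apply, Function.update_apply]
  split_ifs with h
  · rw [h]
  · rfl

lemma smoothFn_prod {ι : Type*} (s : Finset ι) {f : ι → M → ℝ} {y : M}
    (hf : ∀ j, SmoothFnAt n (f j) y) : SmoothFnAt n (fun z => ∏ j ∈ s, f j z) y :=
  contMDiffAt_finsetProd fun i _ => hf i

lemma SmoothFnAt.abs_rpow {f : M → ℝ} {y : M} (hf : SmoothFnAt n f y) (r : ℝ) (h : f y ≠ 0) :
    SmoothFnAt n (fun z => |f z| ^ r) y :=
  ContMDiffAt.comp y (contDiffAt_abs_rpow r h).contMDiffAt hf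

variable [IsManifold (Mdl n) ∞ M] {D : Conn n M} {U : Set M} {r : ℝ}

variable (n) in
/-- The components of the coordinate frame at `x` in the coordinate frame at `y`. -/
def frameMatrix (x y z : M) : Matrix (Fin (n + 1)) (Fin (n + 1)) ℝ :=
  Matrix.of fun k j => coordCoeff y k z (coordField x j z)

lemma det_frame {x y z : M} (hz : z ∈ chartDom n y) :
    (coordBasis hz).det (frame (n := n) x z) = (frameMatrix n x y z).det := by
  rw [Basis.det_apply]
  congr 1

lemma det_frameMatrix_ne_zero {x y z : M} (hx : z ∈ chartDom n x) (hy : z ∈ chartDom n y) :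
    (frameMatrix n x y z).det ≠ 0 := by
  rw [← det_frame hy, ← coe_coordBasis hx]
  exact (Basis.isUnit_det _ _).ne_zero

lemma det_frameMatrix_smooth {x y z : M} (hx : z ∈ chartDom n x) (hy : z ∈ chartDom n y) :
    SmoothFnAt n (fun z => (frameMatrix n x y z).det) z := by
  simp only [Matrix.det_apply']
  exact contMDiffAt_finsetSum fun σ _ => contMDiffAt_const.mul (smoothFn_prod _ fun i =>
    coordCoeff_smooth hy (coordField_smoothAt hx i) _)

lemma DensitySection.rep_eq (s : DensitySection n M r) {x y z : M} (hy : z ∈ chartDom n y) :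
    s.rep x z = |(frameMatrix n x y z).det| ^ r * s.rep y z := by
  rw [← det_frame hy, DensitySection.rep, (s z).2 (coordBasis hy), coe_coordBasis hy]
  rfl

/-- Smoothness is defined only through the chart centred at each point. The transition factor is a
power of a smooth nonvanishing determinant, so every other chart can be used. -/
lemma DensitySection.IsSmoothOn.rep_smooth {s : DensitySection n M r} (hs : s.IsSmoothOn U)
    {x y : M} (hy : y ∈ chartDom n x) (hyU : y ∈ U) : SmoothFnAt n (s.rep x) y := by
  have h := ((det_frameMatrix_smooth hy (mem_chartDom y)).abs_rpow r
    (det_frameMatrix_ne_zero hy (mem_chartDom y))).mul (hs y hyU)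
  refine h.congr_of_eventuallyEq ?_
  filter_upwards [chartDom_mem_nhds (mem_chartDom (n := n) y)] with z hz
  exact s.rep_eq hz

/-- The trace of the connection matrix of `D` with respect to the coordinate frame around `x`. -/
def connTrace (D : Conn n M) (x y : M) (v : TangentSpace (Mdl n) y) : ℝ :=
  ∑ i, coordCoeff x i y (D (coordField x i) y v)

/-- The logarithmic derivative of the transition determinant is the difference of the two connection
traces. This makes the induced connection on densities independent of the frame. -/
lemma mvfderiv_det_frameMatrix (hD : IsAffineConnectionOn D U) (hU : IsOpen U) {x y : M}
    (hy : y ∈ chartDom n x) (hyU : y ∈ U) (v : TangentSpace (Mdl n) y) :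
    mvfderiv (Mdl n) (fun z => (frameMatrix n x y z).det) y v =
      (frameMatrix n x y y).det * (connTrace D x y v - connTrace D y y v) := by
  have hyy := mem_chartDom (n := n) y
  have hA : ∀ k j, MDifferentiableAt (Mdl n) 𝓘(ℝ) (fun z => frameMatrix n x y z k j) y :=
    fun k j => (coordCoeff_smooth hyy (coordField_smoothAt hy j) k).mdiff
  rw [(mvfderiv_det hA v).2]
  -- `φ` is the connection matrix in the frame of `y`, viewed as an endomorphism. Subtracting `φ
  -- (e_j)` from `D_v e_j` leaves the derivative of the `j`-th column of the frame matrix.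
  let φ : TangentSpace (Mdl n) y →ₗ[ℝ] TangentSpace (Mdl n) y :=
    { toFun := fun u => ∑ i, coordCoeff y i y u • D (coordField y i) y v
      map_add' := fun u u' => by simp [add_smul, Finset.sum_add_distrib]
      map_smul' := fun c u => by simp [mul_smul, Finset.smul_sum] }
  have hφ : ∀ u, φ u = ∑ i, coordCoeff y i y u • D (coordField y i) y v := fun u => rfl
  set c : Fin (n + 1) → Fin (n + 1) → ℝ := fun j i =>
    coordCoeff x i y (D (coordField x j) y v - φ (coordField x j y)) with hc
  have h1 : ∀ j k, mvfderiv (Mdl n) (fun z => frameMatrix n x y z k j) y v =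
      ∑ i, c j i * frameMatrix n x y y k i := by
    intro j k
    have h2 := hD.coordCoeff_apply hU hyy hyU (coordField_smoothAt hy j).diffAt v k
    have h3 : coordCoeff y k y (D (coordField x j) y v - φ (coordField x j y)) =
        mvfderiv (Mdl n) (fun z => frameMatrix n x y z k j) y v := by
      rw [map_sub, h2, hφ, map_sum]
      simp only [map_smul, smul_eq_mul, add_sub_cancel_right]
      rfl
    rw [← h3]
    conv_lhs => rw [← sum_coordCoeff_smul hy (D (coordField x j) y v - φ (coordField x j y))]
    rw [map_sum]
    simp only [map_smul, smul_eq_mul]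
    rfl
  have h4 : ∀ j, ((frameMatrix n x y y).updateCol j fun i =>
      mvfderiv (Mdl n) (fun z => frameMatrix n x y z i j) y v).det =
      c j j * (frameMatrix n x y y).det := by
    intro j
    -- The new column is a combination of the old ones, and the determinant only sees the
    -- coefficient of the column it replaces.
    rw [← smul_eq_mul, ← Matrix.det_updateCol_sum]
    congr 2
    ext k
    simp [h1]
  simp only [h4]
  rw [← Finset.sum_mul, mul_comm]
  congr 1
  simp only [hc, map_sub, Finset.sum_sub_distrib]
  congr 1
  have h5 := sum_repr_eq_trace (coordBasis hy) (coordBasis hyy) φ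
  simp only [coordBasis_repr, coordBasis_apply] at h5
  rw [h5]
  refine Finset.sum_congr rfl fun i _ => ?_
  rw [hφ]
  simp [coordCoeff_coordField hyy]

/-- The induced connection on densities in the coordinate frame around `x`. -/
lemma DensitySection.covDeriv_frame (hD : IsAffineConnectionOn D U) (hU : IsOpen U)
    {s : DensitySection n M r} {x y : M} (hy : y ∈ chartDom n x) (hyU : y ∈ U)
    (hs : MDifferentiableAt (Mdl n) 𝓘(ℝ) (s.rep y) y) (v : TangentSpace (Mdl n) y) :
    (s.covDeriv D y v).1 (frame x y) =
      mvfderiv (Mdl n) (s.rep x) y v - r * connTrace D x y v * s.rep x y := by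
  have hyy := mem_chartDom (n := n) y
  have hdet := det_frameMatrix_ne_zero hy hyy
  have hg := (det_frameMatrix_smooth hy hyy).mdiff
  have h1 : mvfderiv (Mdl n) (s.rep x) y v =
      |(frameMatrix n x y y).det| ^ r * mvfderiv (Mdl n) (s.rep y) y v + s.rep y y *
        (r * |(frameMatrix n x y y).det| ^ r / (frameMatrix n x y y).det *
          ((frameMatrix n x y y).det * (connTrace D x y v - connTrace D y y v))) := by
    have h2 : s.rep x =ᶠ[𝓝 y] fun z => |(frameMatrix n x y z).det| ^ r * s.rep y z := by
      filter_upwards [chartDom_mem_nhds hyy] with z hz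
      exact s.rep_eq hz
    rw [mvfderiv_congr h2, mvfderiv_mul_apply
      ((det_frameMatrix_smooth hy hyy).abs_rpow r hdet).mdiff hs,
      mvfderiv_comp_real (g := fun z => (frameMatrix n x y z).det)
        (hasDerivAt_abs_rpow' r hdet) hg, mvfderiv_det_frameMatrix hD hU hy hyU]
  have h3 : ∑ i, (stdBasis y).repr (D (ext (stdBasis y i)) y v) i = connTrace D y y v := by
    simp only [stdBasis_repr]
    rfl
  have h4 : (s y).1 (stdBasis y) = s.rep y y := by
    rw [DensitySection.rep, frame_self]
  change |(stdBasis y).det (frame x y)| ^ r * _ = _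
  rw [h1, s.rep_eq (x := x) hyy, h3, h4, ← coordBasis_self, det_frame]
  field_simp
  ring

/-- The coordinate expression of the first covariant derivative of a density of exponent `r`
represented by the function `f` in the coordinate frame around `x`. -/
def covCoord (D : Conn n M) (x : M) (r : ℝ) (f : M → ℝ) (j : Fin (n + 1)) (y : M) : ℝ :=
  pd x j f y - r * (∑ k, christoffel D x k j k y) * f y

/-- The coordinate expression of the second covariant derivative of a density of exponent `r`
represented by the function `f` in the coordinate frame around `x`. -/
def hessCoord (D : Conn n M) (x : M) (r : ℝ) (f : M → ℝ) (i j : Fin (n + 1)) (y : M) : ℝ :=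
  pd x i (covCoord D x r f j) y - r * (∑ k, christoffel D x k i k y) * covCoord D x r f j y
    - ∑ k, christoffel D x k i j y * covCoord D x r f k y

lemma connTrace_eq {x y : M} (hy : y ∈ chartDom n x) (v : TangentSpace (Mdl n) y) :
    connTrace D x y v = ∑ i, coordCoeff x i y v * ∑ k, christoffel D x k i k y := by
  have h : ∀ k, coordCoeff x k y (D (coordField x k) y v) =
      ∑ i, coordCoeff x i y v * christoffel D x k i k y := by
    intro k
    conv_lhs => rw [← sum_coordCoeff_smul hy v]
    simp only [map_sum, map_smul, smul_eq_mul]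
    rfl
  simp only [connTrace, h, Finset.mul_sum]
  exact Finset.sum_comm

lemma DensitySection.covDeriv_frame_eq_sum (hD : IsAffineConnectionOn D U) (hU : IsOpen U)
    {s : DensitySection n M r} {x y : M} (hy : y ∈ chartDom n x) (hyU : y ∈ U)
    (hs : MDifferentiableAt (Mdl n) 𝓘(ℝ) (s.rep y) y) (v : TangentSpace (Mdl n) y) :
    (s.covDeriv D y v).1 (frame x y) =
      ∑ i, coordCoeff x i y v * covCoord D x r (s.rep x) i y := by
  rw [covDeriv_frame hD hU hy hyU hs, connTrace_eq hy, mvfderiv_eq_sum_pd hy, Finset.mul_sum,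
    Finset.sum_mul, ← Finset.sum_sub_distrib]
  refine Finset.sum_congr rfl fun i _ => ?_
  rw [covCoord]
  ring

lemma IsAffineConnectionOn.christoffelTrace_smooth (hD : IsAffineConnectionOn D U) (hU : IsOpen U)
    {x y : M} (hy : y ∈ chartDom n x) (hyU : y ∈ U) (i : Fin (n + 1)) :
    SmoothFnAt n (fun y => ∑ k, christoffel D x k i k y) y :=
  contMDiffAt_finsetSum fun k _ => hD.christoffel_smooth hU hy hyU k i k

lemma covCoord_smooth (hD : IsAffineConnectionOn D U) (hU : IsOpen U)
    {x y : M} (hy : y ∈ chartDom n x) (hyU : y ∈ U) {f : M → ℝ} (hf : SmoothFnAt n f y) (r : ℝ)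
    (j : Fin (n + 1)) : SmoothFnAt n (covCoord D x r f j) y :=
  (pd_smooth hy j hf).sub ((contMDiffAt_const.mul (hD.christoffelTrace_smooth hU hy hyU j)).mul hf)

lemma hessCoord_smooth (hD : IsAffineConnectionOn D U) (hU : IsOpen U)
    {x y : M} (hy : y ∈ chartDom n x) (hyU : y ∈ U) {f : M → ℝ} (hf : SmoothFnAt n f y) (r : ℝ)
    (i j : Fin (n + 1)) : SmoothFnAt n (hessCoord D x r f i j) y :=
  ((pd_smooth hy i (covCoord_smooth hD hU hy hyU hf r j)).sub
    ((contMDiffAt_const.mul (hD.christoffelTrace_smooth hU hy hyU i)).mul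
      (covCoord_smooth hD hU hy hyU hf r j))).sub
    (contMDiffAt_finsetSum fun k _ => (hD.christoffel_smooth hU hy hyU k i j).mul
      (covCoord_smooth hD hU hy hyU hf r k))

lemma coordCoeff_ext {x y : M} (hy : y ∈ chartDom n x) (w : TangentSpace (Mdl n) x)
    (k : Fin (n + 1)) : coordCoeff x k y (ext w y) = coordCoeff x k x w := by
  have h : ∀ {y} (hy : y ∈ chartDom n x), coordCoeff x k y (ext w y) = modelVec w k := by
    intro y hy
    rw [ext_eq hy, coordCoeff, ContinuousLinearMap.comp_apply,
      Bundle.Trivialization.continuousLinearMapAt_symmL _ (mem_chartTriv hy)]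
    rfl
  rw [h hy, ← h (mem_chartDom x), ext_self]

/-- The second covariant derivative of a density in coordinates. -/
lemma DensitySection.hess_stdBasis (hD : IsAffineConnectionOn D U) (hU : IsOpen U)
    {s : DensitySection n M r} (hs : s.IsSmoothOn U) {x : M} (hx : x ∈ U)
    (v w : TangentSpace (Mdl n) x) :
    (DensitySection.hess D s x v w).1 (stdBasis x) =
      ∑ i, ∑ j, coordCoeff x i x v * coordCoeff x j x w * hessCoord D x r (s.rep x) i j x := by
  have hxx := mem_chartDom (n := n) x
  set t : DensitySection n M r := fun y => s.covDeriv D y (ext w y) with ht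
  have hsr : SmoothFnAt n (s.rep x) x := hs.rep_smooth hxx hx
  have hc : ∀ j, SmoothFnAt n (covCoord D x r (s.rep x) j) x :=
    fun j => covCoord_smooth hD hU hxx hx hsr r j
  have hct : ∀ j, MDifferentiableAt (Mdl n) 𝓘(ℝ)
      (fun y => coordCoeff x j x w * covCoord D x r (s.rep x) j y) x :=
    fun j => mdifferentiableAt_const.mul (hc j).mdiff
  -- `ext w` has constant coefficients in the chart at `x`, so only the coordinate derivatives of
  -- `s` get differentiated again.
  have h1 : t.rep x =ᶠ[𝓝 x] fun y => ∑ j, coordCoeff x j x w * covCoord D x r (s.rep x) j y := by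
    filter_upwards [chartDom_mem_nhds hxx, hU.mem_nhds hx] with y hy hyU
    rw [DensitySection.rep, ht, covDeriv_frame_eq_sum hD hU hy hyU
      (hs.rep_smooth (mem_chartDom y) hyU).mdiff]
    simp only [coordCoeff_ext hy]
  have htd : MDifferentiableAt (Mdl n) 𝓘(ℝ) (t.rep x) x :=
    (mdiff_sum _ hct).congr_of_eventuallyEq h1
  have h2 : (DensitySection.hess D s x v w).1 (frame x x) = (t.covDeriv D x v).1 (frame x x)
      - (s.covDeriv D x (D (ext w) x v)).1 (frame x x) := rfl
  have h3 : ∀ k, coordCoeff x k x (D (ext w) x v) =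
      ∑ j, coordCoeff x j x w * ∑ i, coordCoeff x i x v * christoffel D x k i j x := by
    intro k
    have h4 : (fun y => coordCoeff x k y (ext w y)) =ᶠ[𝓝 x] fun _ => coordCoeff x k x w := by
      filter_upwards [chartDom_mem_nhds hxx] with y hy using coordCoeff_ext hy w k
    rw [hD.coordCoeff_apply hU hxx hx (ext_smooth hxx w).diffAt, mvfderiv_congr h4, mvfderiv_const,
      zero_apply, zero_add, ext_self]
    refine Finset.sum_congr rfl fun j _ => congrArg _ ?_
    conv_lhs => rw [← sum_coordCoeff_smul hxx v]
    simp only [map_sum, map_smul, smul_eq_mul]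
    rfl
  have h5 : ∀ i, covCoord D x r (t.rep x) i x = ∑ j, coordCoeff x j x w *
      (pd x i (covCoord D x r (s.rep x) j) x
        - r * (∑ k, christoffel D x k i k x) * covCoord D x r (s.rep x) j x) := by
    intro i
    rw [covCoord, pd_congr x i h1, h1.eq_of_nhds, pd_sum x i _ hct]
    simp only [pd_const_mul x i _ (hc _).mdiff, Finset.mul_sum, mul_sub, Finset.sum_sub_distrib]
    congr 1
    refine Finset.sum_congr rfl fun j _ => ?_
    ring
  rw [← frame_self, h2, covDeriv_frame_eq_sum hD hU hxx hx htd,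
    covDeriv_frame_eq_sum hD hU hxx hx hsr.mdiff]
  simp only [h3, h5, Finset.mul_sum, Finset.sum_mul, hessCoord, mul_sub, Finset.sum_sub_distrib,
    mul_assoc]
  congr 1
  rw [Finset.sum_comm]
  rw [Finset.sum_congr rfl fun j _ => Finset.sum_comm, Finset.sum_comm]
  refine Finset.sum_congr rfl fun i _ => Finset.sum_congr rfl fun j _ =>
    Finset.sum_congr rfl fun k _ => ?_
  ring

end ProjComp

/-! ### Projective changes and the first BGG equation. -/

namespace ProjComp

/-- The quadratic Christoffel terms of the Ricci tensor after a projective change, isolated as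
finite algebra. It is used with `N = n + 1`, where `N - 1` becomes `n`. -/
lemma sum_projective_quadratic {N : ℕ} (G : Fin N → Fin N → Fin N → ℝ) (Y : Fin N → ℝ)
    (hG : ∀ k i j, G k i j = G k j i) (j l : Fin N) :
    ∑ i, ∑ k, ((G k j l + (Y j * (if k = l then 1 else 0) + Y l * (if k = j then 1 else 0))) *
        (G i i k + (Y i * (if i = k then 1 else 0) + Y k * (if i = i then 1 else 0)))
      - (G k i l + (Y i * (if k = l then 1 else 0) + Y l * (if k = i then 1 else 0))) *
        (G i j k + (Y j * (if i = k then 1 else 0) + Y k * (if i = j then 1 else 0)))) =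
    ∑ i, ∑ k, (G k j l * G i i k - G k i l * G i j k)
      + ((N : ℝ) - 1) * ∑ k, G k j l * Y k + ((N : ℝ) - 1) * (Y j * Y l) := by
  have h2 : ∑ i, G i j i = ∑ i, G i i j := Finset.sum_congr rfl fun i _ => hG i j i
  simp only [mul_add, add_mul, Finset.sum_add_distrib, Finset.sum_sub_distrib]
  simp only [mul_ite, ite_mul, mul_one, mul_zero, zero_mul, Finset.sum_ite_eq, Finset.sum_ite_eq',
    Finset.mem_univ, if_true, Finset.sum_const, Finset.card_univ, Fintype.card_fin, nsmul_eq_mul,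
    Finset.sum_ite_irrel]
  simp only [← Finset.sum_mul, h2, mul_comm (Y _) (G _ _ _)]
  ring

variable {n : ℕ} {M : Type*} [TopologicalSpace M] [ChartedSpace (EuclideanHalfSpace (n + 1)) M]
  [IsManifold (Mdl n) ∞ M] {D D' : Conn n M} {U W : Set M} {Υ : OneForm n M}

/-- The components of a one-form in the preferred chart at `x`. -/
def formCoord (Υ : OneForm n M) (x : M) (i : Fin (n + 1)) (y : M) : ℝ := Υ y (coordField x i y)

lemma OneForm.IsSmoothOn.formCoord_smooth (hΥ : Υ.IsSmoothOn W) (hW : IsOpen W) {x y : M}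
    (hy : y ∈ chartDom n x) (hyW : y ∈ W) (i : Fin (n + 1)) :
    SmoothFnAt n (formCoord Υ x i) y := by
  have hV : IsOpen (W ∩ chartDom n x) :=
    hW.inter (chartAt (EuclideanHalfSpace (n + 1)) x).open_source
  exact (hΥ _ hV inter_subset_left _ ((coordField_smoothOn x i).mono inter_subset_right) y
    ⟨hyW, hy⟩).contMDiffAt (hV.mem_nhds ⟨hyW, hy⟩)

lemma IsProjectiveChangeOn.christoffel_eq (h : IsProjectiveChangeOn D D' Υ W) {x y : M}
    (hy : y ∈ chartDom n x) (hyW : y ∈ W) (k i j : Fin (n + 1)) :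
    christoffel D' x k i j y = christoffel D x k i j y +
      (formCoord Υ x i y * (if k = j then 1 else 0) +
        formCoord Υ x j y * (if k = i then 1 else 0)) := by
  rw [christoffel, h y hyW _ (coordField_smoothAt hy j).diffAt]
  simp [coordCoeff_coordField hy, christoffel, formCoord, add_assoc]

/-- The factor is `n + 2 = (n + 1) + 1`: the dimension from the trace of the identity, and one more
from the symmetric partner term. It is cancelled by the exponent `-1 / (n + 2)` of weight one
densities. -/
lemma IsProjectiveChangeOn.christoffelTrace_eq (h : IsProjectiveChangeOn D D' Υ W) {x y : M}
    (hy : y ∈ chartDom n x) (hyW : y ∈ W) (i : Fin (n + 1)) :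
    ∑ k, christoffel D' x k i k y =
      ∑ k, christoffel D x k i k y + ((n : ℝ) + 2) * formCoord Υ x i y := by
  simp only [h.christoffel_eq hy hyW, Finset.sum_add_distrib]
  simp
  ring

/-- The change of the Ricci tensor under a projective change of connection. -/
lemma IsProjectiveChangeOn.ricciCoord_eq (hD : IsAffineConnectionOn D U) (hU : IsOpen U)
    (h : IsProjectiveChangeOn D D' Υ W) (hW : IsOpen W) (hWU : W ⊆ U) (hΥ : Υ.IsSmoothOn W)
    {x y : M} (hy : y ∈ chartDom n x) (hyW : y ∈ W) (j l : Fin (n + 1)) :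
    ricciCoord D' x j l y = ricciCoord D x j l y + pd x l (formCoord Υ x j) y
      - ((n : ℝ) + 1) * pd x j (formCoord Υ x l) y
      + n * ∑ k, christoffel D x k j l y * formCoord Υ x k y
      + n * (formCoord Υ x j y * formCoord Υ x l y) := by
  have hΓ : ∀ k i j, MDifferentiableAt (Mdl n) 𝓘(ℝ) (christoffel D x k i j) y :=
    fun k i j => (hD.christoffel_smooth hU hy (hWU hyW) k i j).mdiff
  have hY : ∀ i, MDifferentiableAt (Mdl n) 𝓘(ℝ) (formCoord Υ x i) y :=
    fun i => (hΥ.formCoord_smooth hW hy hyW i).mdiff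
  have hpd : ∀ m k i j : Fin (n + 1), pd x m (christoffel D' x k i j) y = pd x m (christoffel D x k i j) y +
      (pd x m (formCoord Υ x i) y * (if k = j then 1 else 0) +
        pd x m (formCoord Υ x j) y * (if k = i then 1 else 0)) := by
    intro m k i j
    have he : christoffel D' x k i j =ᶠ[𝓝 y] fun z => christoffel D x k i j z +
      ((if k = j then 1 else 0) * formCoord Υ x i z +
        (if k = i then 1 else 0) * formCoord Υ x j z) := by
      filter_upwards [chartDom_mem_nhds hy, hW.mem_nhds hyW] with z hz hzW
      rw [h.christoffel_eq hz hzW]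
      ring
    have hc : ∀ (c : ℝ) i, MDifferentiableAt (Mdl n) 𝓘(ℝ) (fun z => c * formCoord Υ x i z) y :=
      fun c i => mdifferentiableAt_const.mul (hY i)
    rw [pd_congr x m he, pd_add x m (hΓ k i j) (g := fun z => _ + _) ((hc _ i).add (hc _ j)),
      pd_add x m (hc _ i) (hc _ j),
      pd_const_mul x m _ (hY i), pd_const_mul x m _ (hY j)]
    ring
  have hq := sum_projective_quadratic (fun k i j => christoffel D x k i j y)
    (fun i => formCoord Υ x i y) (fun k i j => hD.christoffel_symm hy (hWU hyW) k i j) j l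
  simp only [ricciCoord, riemCoord, hpd, h.christoffel_eq hy hyW, Finset.sum_add_distrib] at hq ⊢
  rw [hq]
  simp only [Finset.sum_sub_distrib, Finset.sum_add_distrib]
  simp
  ring

/-- The coordinate expression of the left hand side of the first BGG equation. -/
def bggCoord (D : Conn n M) (x : M) (f : M → ℝ) (i j : Fin (n + 1)) (y : M) : ℝ :=
  (hessCoord D x (-1 / ((n : ℝ) + 2)) f i j y + hessCoord D x (-1 / ((n : ℝ) + 2)) f j i y) / 2
    + 1 / (n : ℝ) * ((ricciCoord D x i j y + ricciCoord D x j i y) / 2) * f y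

lemma pd_of_covCoord_eq {r : ℝ} {f : M → ℝ} {x y : M} (i : Fin (n + 1)) :
    pd x i f y = covCoord D x r f i y + r * (∑ k, christoffel D x k i k y) * f y := by
  rw [covCoord]
  ring

/-- A density whose logarithmic covariant derivative is `-Υ` solves the first BGG equation for `D`
when the symmetrized Ricci tensor of `D' = D + Υ` vanishes. -/
lemma bggCoord_eq_zero (hn : n ≠ 0) (hD : IsAffineConnectionOn D U) (hU : IsOpen U)
    (h : IsProjectiveChangeOn D D' Υ W) (hW : IsOpen W) (hWU : W ⊆ U) (hΥ : Υ.IsSmoothOn W)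
    {x y : M} (hy : y ∈ chartDom n x) (hyW : y ∈ W) {f : M → ℝ} (hf : SmoothFnAt n f y)
    (hcov : ∀ z ∈ W ∩ chartDom n x, ∀ i,
      covCoord D x (-1 / ((n : ℝ) + 2)) f i z = - (formCoord Υ x i z * f z))
    (hric : ∀ i j, ricciCoord D' x i j y + ricciCoord D' x j i y = 0) (i j : Fin (n + 1)) :
    bggCoord D x f i j y = 0 := by
  have hn' : (n : ℝ) ≠ 0 := Nat.cast_ne_zero.2 hn
  have hY : ∀ i, MDifferentiableAt (Mdl n) 𝓘(ℝ) (formCoord Υ x i) y :=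
    fun i => (hΥ.formCoord_smooth hW hy hyW i).mdiff
  have hpd : ∀ i, pd x i f y = - (formCoord Υ x i y * f y)
      + -1 / ((n : ℝ) + 2) * (∑ k, christoffel D x k i k y) * f y := fun i => by
    rw [← hcov y ⟨hyW, hy⟩, ← pd_of_covCoord_eq]
  -- Differentiating `Df = -Υf` once more gives `D²f = f (-DΥ + Υ ⊗ Υ)`. The density trace terms
  -- cancel.
  have hess : ∀ i j, hessCoord D x (-1 / ((n : ℝ) + 2)) f i j y = f y *
      (- pd x i (formCoord Υ x j) y + formCoord Υ x i y * formCoord Υ x j y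
        + ∑ k, christoffel D x k i j y * formCoord Υ x k y) := by
    intro i j
    have he : covCoord D x (-1 / ((n : ℝ) + 2)) f j =ᶠ[𝓝 y]
        fun z => -1 * (formCoord Υ x j z * f z) := by
      filter_upwards [chartDom_mem_nhds hy, hW.mem_nhds hyW] with z hz hzW
      rw [hcov z ⟨hzW, hz⟩]
      ring
    have hsum : ∑ k, christoffel D x k i j y * covCoord D x (-1 / ((n : ℝ) + 2)) f k y =
        - ((∑ k, christoffel D x k i j y * formCoord Υ x k y) * f y) := by
      rw [Finset.sum_mul, ← Finset.sum_neg_distrib]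
      refine Finset.sum_congr rfl fun k _ => ?_
      rw [hcov y ⟨hyW, hy⟩]
      ring
    rw [hessCoord, pd_congr x i he, pd_const_mul x i _ (f := fun z => _ * _) ((hY j).mul hf.mdiff),
      pd_mul x i (hY j) hf.mdiff, hpd, hsum, hcov y ⟨hyW, hy⟩]
    ring
  have hΓ : ∑ k, christoffel D x k j i y * formCoord Υ x k y =
      ∑ k, christoffel D x k i j y * formCoord Υ x k y :=
    Finset.sum_congr rfl fun k _ => by rw [hD.christoffel_symm hy (hWU hyW)]
  -- Vanishing of the symmetrized Ricci tensor of `D'` says that the symmetric Schouten tensor of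
  -- `D` is the symmetric part of `DΥ - Υ ⊗ Υ`, the negative of the factor in `hess`.
  have hr := hric i j
  rw [h.ricciCoord_eq hD hU hW hWU hΥ hy hyW, h.ricciCoord_eq hD hU hW hWU hΥ hy hyW, hΓ] at hr
  rw [bggCoord, hess, hess, hΓ]
  field_simp
  linear_combination f y * hr

lemma weightOneDensity_rep (κ : DensitySection n M 1) (x : M) :
    DensitySection.rep (weightOneDensity κ) x = fun y => |κ.rep x y| ^ (-1 / ((n : ℝ) + 2)) := rfl

/-- The logarithmic derivative of the weight one density of a volume density that is parallel for
`D' = D + Υ`. -/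
lemma covCoord_weightOneDensity (hD' : IsAffineConnectionOn D' W)
    (h : IsProjectiveChangeOn D D' Υ W) (hW : IsOpen W) {κ : DensitySection n M 1}
    (hκ : κ.IsSmoothOn W) (hne : ∀ y ∈ W, κ y ≠ 0) (hpar : κ.IsParallelOn D' W)
    {x y : M} (hy : y ∈ chartDom n x) (hyW : y ∈ W) (i : Fin (n + 1)) :
    covCoord D x (-1 / ((n : ℝ) + 2)) (DensitySection.rep (weightOneDensity κ) x) i y =
      - (formCoord Υ x i y * DensitySection.rep (weightOneDensity κ) x y) := by
  have hk : κ.rep x y ≠ 0 := by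
    have := hne y hyW
    rwa [Ne, Density.eq_zero_iff _ (coordBasis hy), coe_coordBasis] at this
  have h1 := DensitySection.covDeriv_frame_eq_sum hD' hW hy hyW
    (hκ.rep_smooth (mem_chartDom y) hyW).mdiff (coordField x i y)
  rw [hpar y hyW] at h1
  have h2 : covCoord D' x 1 (κ.rep x) i y = 0 := by
    have h3 : (0 : ℝ) = covCoord D' x 1 (κ.rep x) i y := by
      simpa [coordCoeff_coordField hy] using h1
    exact h3.symm
  have h4 : pd x i (DensitySection.rep (weightOneDensity κ) x) y = _ :=
    mvfderiv_comp_real (hasDerivAt_abs_rpow' (-1 / ((n : ℝ) + 2)) hk)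
      (hκ.rep_smooth hy hyW).mdiff (coordField x i y)
  have h5 : mvfderiv (Mdl n) (κ.rep x) y (coordField x i y) =
      (∑ k, christoffel D x k i k y + ((n : ℝ) + 2) * formCoord Υ x i y) * κ.rep x y := by
    rw [← h.christoffelTrace_eq hy hyW]
    rw [covCoord, pd] at h2
    linear_combination h2
  have hn2 : (n : ℝ) + 2 ≠ 0 := by positivity
  rw [covCoord, h4, h5, weightOneDensity_rep]
  field_simp
  ring

end ProjComp

/-! ### Building smooth connections by projective change. -/

namespace ProjComp

variable {n : ℕ} {M : Type*} [TopologicalSpace M] [ChartedSpace (EuclideanHalfSpace (n + 1)) M]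

/-- The projective change of a connection by a one-form. -/
def projChange (D : Conn n M) (Υ : OneForm n M) : Conn n M := fun Y z =>
  D Y z + ((Υ z).smulRight (Y z) + Υ z (Y z) • ContinuousLinearMap.id ℝ (TangentSpace (Mdl n) z))

lemma projChange_apply (D : Conn n M) (Υ : OneForm n M) (Y : VField n M) (z : M)
    (v : TangentSpace (Mdl n) z) :
    projChange D Υ Y z v = D Y z v + Υ z v • Y z + Υ z (Y z) • v := by
  rw [projChange, add_assoc]
  rfl

variable [IsManifold (Mdl n) ∞ M] {D D' : Conn n M} {U W : Set M} {Υ Υ' : OneForm n M}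

/-- A section of the endomorphism bundle is smooth if its coordinate components are. -/
lemma smoothAt_hom_of_coord {φ : Π z : M, TangentSpace (Mdl n) z →L[ℝ] TangentSpace (Mdl n) z}
    {x : M} (h : ∀ k i, SmoothFnAt n (fun z => coordCoeff x k z (φ z (coordField x i z))) x) :
    ContMDiffAt (Mdl n) ((Mdl n).prod 𝓘(ℝ, EuclideanSpace ℝ (Fin (n + 1)) →L[ℝ]
        EuclideanSpace ℝ (Fin (n + 1)))) ∞
      (fun z => Bundle.TotalSpace.mk' (EuclideanSpace ℝ (Fin (n + 1)) →L[ℝ]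
        EuclideanSpace ℝ (Fin (n + 1)))
        (E := fun z : M => TangentSpace (Mdl n) z →L[ℝ] TangentSpace (Mdl n) z) z (φ z)) x := by
  rw [contMDiffAt_hom_bundle]
  refine ⟨contMDiffAt_id, ?_⟩
  set b := EuclideanSpace.basisFun (Fin (n + 1)) ℝ with hb
  have h1 : ContMDiffAt (Mdl n) 𝓘(ℝ, EuclideanSpace ℝ (Fin (n + 1)) →L[ℝ]
        EuclideanSpace ℝ (Fin (n + 1))) ∞ (fun z => ∑ k, ∑ i,
      coordCoeff x k z (φ z (coordField x i z)) •
        (EuclideanSpace.proj i : EuclideanSpace ℝ (Fin (n + 1)) →L[ℝ] ℝ).smulRight (b k)) x :=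
    contMDiffAt_finsetSum fun k _ => contMDiffAt_finsetSum fun i _ =>
      (h k i).smul contMDiffAt_const
  refine h1.congr_of_eventuallyEq ?_
  filter_upwards [chartDom_mem_nhds (mem_chartDom (n := n) x)] with z hz
  refine ContinuousLinearMap.coe_injective (b.toBasis.ext fun i' => ?_)
  ext k'
  have h2 : ∀ c : Fin (n + 1) → Fin (n + 1) → ℝ, (∑ k, ∑ i, c k i •
      (EuclideanSpace.proj i : EuclideanSpace ℝ (Fin (n + 1)) →L[ℝ] ℝ).smulRight (b k))
      (b.toBasis i') k' = c k' i' := by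
    intro c
    simp [hb, sum_apply, Pi.single_apply]
  refine Eq.trans ?_ (h2 fun k i => coordCoeff x k z (φ z (coordField x i z))).symm
  rw [coordField_eq hz]
  rfl

/-- The added term is linear over functions, which keeps the Leibniz rule, and symmetric in its two
vector arguments, which keeps the torsion zero. -/
lemma IsAffineConnectionOn.projChange (hD : IsAffineConnectionOn D U) (hWU : W ⊆ U)
    (hΥ : Υ.IsSmoothOn W) : IsAffineConnectionOn (projChange D Υ) W where
  covariant :=
    { add := by
        intro σ σ' x hσ hσ' hx
        ext1 v
        rw [add_apply, projChange_apply, projChange_apply, projChange_apply,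
          hD.covariant.add hσ hσ' (hWU hx), Pi.add_apply, map_add, add_apply]
        module
      leibniz := by
        intro σ g x hσ hg hx
        ext1 v
        rw [add_apply, smul_apply, ContinuousLinearMap.smulRight_apply, projChange_apply,
          projChange_apply, hD.covariant.leibniz hσ hg (hWU hx), add_apply, smul_apply,
          ContinuousLinearMap.smulRight_apply, Pi.smul_apply', map_smul]
        module }
  smooth := fun V hV hVW =>
    { contMDiff := by
        intro σ hσ x hx
        have hσ' : VField.IsSmoothOn σ V := hσ
        have hdom : IsOpen (V ∩ chartDom n x) :=
          hV.inter (chartAt (EuclideanHalfSpace (n + 1)) x).open_source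
        have hxx := mem_chartDom (n := n) x
        refine (smoothAt_hom_of_coord fun k i => ?_).contMDiffWithinAt
        have h1 : SmoothFnAt n (fun z => coordCoeff x k z (D σ z (coordField x i z))) x :=
          coordCoeff_smooth hxx (hD.smoothAt_apply hV (hVW.trans hWU) hσ' hx
            (coordField_smoothAt hxx i)) k
        have h2 : SmoothFnAt n (formCoord Υ x i) x :=
          OneForm.IsSmoothOn.formCoord_smooth (W := V) (fun V' h h' => hΥ V' h (h'.trans hVW))
            hV hxx hx i
        have h3 : SmoothFnAt n (fun z => coordCoeff x k z (σ z)) x :=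
          coordCoeff_smooth hxx (hσ'.smoothAt hV hx) k
        have h4 : SmoothFnAt n (fun z => Υ z (σ z)) x :=
          (hΥ V hV hVW σ hσ' x hx).contMDiffAt (hV.mem_nhds hx)
        refine ((h1.add (h2.mul h3)).add (h4.mul (contMDiffAt_const
          (c := if k = i then (1 : ℝ) else 0)))).congr_of_eventuallyEq ?_
        filter_upwards [chartDom_mem_nhds hxx] with z hz
        rw [projChange_apply, map_add, map_add, map_smul, map_smul, coordCoeff_coordField hz]
        rfl }
  torsion_free := fun X Y x hx hX hY => by
    rw [projChange_apply, projChange_apply, ← hD.torsion_free X Y x (hWU hx) hX hY]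
    module

/-- The one-form with given components in the preferred chart at `x`. -/
def formOfCoord (x : M) (g : Fin (n + 1) → M → ℝ) : OneForm n M :=
  fun z => ∑ i, g i z • coordCoeff x i z

lemma formOfCoord_apply (x : M) (g : Fin (n + 1) → M → ℝ) (z : M) (v : TangentSpace (Mdl n) z) :
    formOfCoord x g z v = ∑ i, g i z * coordCoeff x i z v := by
  rw [formOfCoord, sum_apply]
  rfl

lemma formCoord_formOfCoord {x y : M} (hy : y ∈ chartDom n x) (g : Fin (n + 1) → M → ℝ)
    (i : Fin (n + 1)) : formCoord (formOfCoord x g) x i y = g i y := by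
  rw [formCoord, formOfCoord_apply]
  simp [coordCoeff_coordField hy]

lemma formOfCoord_isSmoothOn {x : M} {g : Fin (n + 1) → M → ℝ} (hW : W ⊆ chartDom n x)
    (hg : ∀ i, ∀ y ∈ W, SmoothFnAt n (g i) y) : (formOfCoord x g).IsSmoothOn W := by
  intro V hV hVW X hX y hy
  simp only [formOfCoord_apply]
  exact (contMDiffAt_finsetSum fun i _ => (hg i y (hVW hy)).mul
    (coordCoeff_smooth (hW (hVW hy)) (hX.smoothAt hV hy) i)).contMDiffWithinAt

lemma form_ext {x y : M} (hy : y ∈ chartDom n x) (h : ∀ i, formCoord Υ x i y = formCoord Υ' x i y) :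
    Υ y = Υ' y := by
  ext1 v
  rw [← sum_coordCoeff_smul hy v, map_sum, map_sum]
  refine Finset.sum_congr rfl fun i _ => ?_
  rw [map_smul, map_smul]
  exact congrArg _ (h i)

end ProjComp

/-! ### Prolongation of the BGG equation and extension to the boundary. -/

namespace ProjComp

section HalfBall

variable {m : ℕ} (c : EuclideanSpace ℝ (Fin (m + 1))) (ε : ℝ)

/-- The open half ball around a point of the closed half space. -/
def halfBall : Set (EuclideanSpace ℝ (Fin (m + 1))) := Metric.ball c ε ∩ {z | 0 < z 0}

lemma isOpen_pos_halfSpace : IsOpen {z : EuclideanSpace ℝ (Fin (m + 1)) | 0 < z 0} :=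
  isOpen_lt continuous_const (EuclideanSpace.proj (𝕜 := ℝ) (0 : Fin (m + 1))).continuous

lemma isOpen_halfBall : IsOpen (halfBall c ε) := Metric.isOpen_ball.inter isOpen_pos_halfSpace

lemma convex_halfBall : Convex ℝ (halfBall c ε) :=
  (convex_ball c ε).inter (convex_halfSpace_gt
    (EuclideanSpace.proj (𝕜 := ℝ) (0 : Fin (m + 1))).isLinear 0)

lemma closure_halfBall_subset :
    closure (halfBall c ε) ⊆ Metric.closedBall c ε ∩ {z | 0 ≤ z 0} := by
  refine closure_minimal (fun z hz => ⟨Metric.ball_subset_closedBall hz.1, ?_⟩) ?_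
  · exact show (0 : ℝ) ≤ z 0 from le_of_lt (show (0 : ℝ) < z 0 from hz.2)
  exact Metric.isClosed_closedBall.inter
    (isClosed_le continuous_const (EuclideanSpace.proj (𝕜 := ℝ) (0 : Fin (m + 1))).continuous)

/-- With `closure_halfBall_subset` this traps the closure between two sets involving the closed half
space, which is all that is needed about it. -/
lemma subset_closure_halfBall :
    Metric.ball c ε ∩ {z | 0 ≤ z 0} ⊆ closure (halfBall c ε) := by
  rw [← closure_open_halfSpace 2 0 0]
  exact Metric.isOpen_ball.inter_closure

lemma isCompact_closure_halfBall : IsCompact (closure (halfBall c ε)) :=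
  (isCompact_closedBall c ε).of_isClosed_subset isClosed_closure
    ((closure_halfBall_subset c ε).trans inter_subset_left)

end HalfBall

variable {n : ℕ} {M : Type*} [TopologicalSpace M] [ChartedSpace (EuclideanHalfSpace (n + 1)) M]

lemma range_mdl : range (Mdl n) = {z | 0 ≤ z 0} :=
  range_modelWithCornersEuclideanHalfSpace (n + 1)

variable [IsManifold (Mdl n) ∞ M] {D : Conn n M} {U : Set M}

lemma isOpen_interior_mdl : IsOpen ((Mdl n).interior M) :=
  (Mdl n).isOpen_interior (n := ∞) (by simp)

/-- Interior points are defined by the preferred chart at `y`. Smooth invariance of the interior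
allows testing in the chart at `x`. -/
lemma mem_interior_iff {x y : M} (hy : y ∈ chartDom n x) :
    y ∈ (Mdl n).interior M ↔ 0 < (extChartAt (Mdl n) x y) 0 := by
  have h := (Mdl n).isInteriorPoint_iff_of_mem_atlas (n := ∞) (by simp)
    (chart_mem_atlas (EuclideanHalfSpace (n + 1)) x) hy
  have h2 : interior (range (Mdl n)) = {z | 0 < z 0} :=
    interior_range_modelWithCornersEuclideanHalfSpace (n + 1)
  refine h.trans ⟨fun h' => ?_, fun h' => ?_⟩
  · exact h2.subset (OpenPartialHomeomorph.interior_extend_target_subset_interior_range _ h')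
  · exact OpenPartialHomeomorph.mem_interior_extend_target _
      ((chartAt (EuclideanHalfSpace (n + 1)) x).map_source hy) (h2.superset h')

/-- Density of the interior is used twice: to carry the BGG equation to the boundary, and to find
points near the boundary where the density is nonzero. -/
lemma mem_closure_interior (x : M) : x ∈ closure ((Mdl n).interior M) := by
  have hmem : extChartAt (Mdl n) x x ∈ range (Mdl n) := extChartAt_mem_range (mem_chartDom x)
  rw [mem_closure_iff_frequently, ← map_extChartAt_symm_nhdsWithin_range (I := Mdl n) x,
    Filter.frequently_map]
  have h1 : ∃ᶠ z in 𝓝[range (Mdl n)] (extChartAt (Mdl n) x x), 0 < z 0 := by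
    rw [frequently_nhdsWithin_iff]
    rw [range_mdl, ← closure_open_halfSpace 2 0 0, mem_closure_iff_frequently] at hmem
    refine hmem.mono fun z hz => ⟨hz, ?_⟩
    rw [range_mdl]
    exact show (0 : ℝ) ≤ z 0 from le_of_lt (show (0 : ℝ) < z 0 from hz)
  refine (h1.and_eventually (extChartAt_target_mem_nhdsWithin x)).mono fun z hz => ?_
  rw [mem_interior_iff (x := x) (by simpa using (extChartAt (Mdl n) x).map_target hz.2),
    (extChartAt (Mdl n) x).right_inv hz.2]
  exact hz.1

/-- The coefficients of the closed linear system for the `1`-jet of a solution of the first BGG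
equation. -/
def bggCoeff (D : Conn n M) (x : M) (i : Fin (n + 1)) :
    Option (Fin (n + 1)) → Option (Fin (n + 1)) → M → ℝ
  | none, none => fun _ => 0
  | none, some k => fun _ => if i = k then 1 else 0
  | some j, none => fun y =>
      -1 / ((n : ℝ) + 2) / 2 * (pd x i (fun y => ∑ k, christoffel D x k j k y) y
        + pd x j (fun y => ∑ k, christoffel D x k i k y) y)
      - (-1 / ((n : ℝ) + 2)) ^ 2 * ((∑ k, christoffel D x k i k y) * ∑ k, christoffel D x k j k y)
      - -1 / ((n : ℝ) + 2) * ∑ l, christoffel D x l i j y * ∑ k, christoffel D x k l k y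
      - 1 / (n : ℝ) * ((ricciCoord D x i j y + ricciCoord D x j i y) / 2)
  | some j, some k => fun y =>
      -1 / ((n : ℝ) + 2) * ((∑ k, christoffel D x k j k y) * (if i = k then 1 else 0)
        + (∑ k, christoffel D x k i k y) * (if j = k then 1 else 0)) + christoffel D x k i j y

/-- The `1`-jet of a function in the preferred chart at `x`. -/
def jet (x : M) (f : M → ℝ) : Option (Fin (n + 1)) → M → ℝ
  | none => f
  | some k => pd x k f

lemma jet_smooth {x y : M} (hy : y ∈ chartDom n x) {f : M → ℝ} (hf : SmoothFnAt n f y)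
    (α : Option (Fin (n + 1))) : SmoothFnAt n (jet x f α) y := by
  cases α with
  | none => exact hf
  | some k => exact pd_smooth hy k hf

lemma bggCoeff_smooth (hD : IsAffineConnectionOn D U) (hU : IsOpen U) {x y : M}
    (hy : y ∈ chartDom n x) (hyU : y ∈ U) (i : Fin (n + 1)) (α β : Option (Fin (n + 1))) :
    SmoothFnAt n (bggCoeff D x i α β) y := by
  have hΓ := fun k i j => hD.christoffel_smooth hU hy hyU k i j
  have hθ := fun i => hD.christoffelTrace_smooth hU hy hyU i
  have hR := fun i j => hD.ricciCoord_smooth hU hy hyU i j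
  match α, β with
  | none, none => exact contMDiffAt_const
  | none, some k => exact contMDiffAt_const
  | some j, none =>
    exact (((contMDiffAt_const.mul ((pd_smooth hy i (hθ j)).add (pd_smooth hy j (hθ i)))).sub
      (contMDiffAt_const.mul ((hθ i).mul (hθ j)))).sub (contMDiffAt_const.mul
        (contMDiffAt_finsetSum fun l _ => (hΓ l i j).mul (hθ l)))).sub
      (contMDiffAt_const.mul (((hR i j).add (hR j i)).div_const 2))
  | some j, some k =>
    exact (contMDiffAt_const.mul (((hθ j).mul contMDiffAt_const).add
      ((hθ i).mul contMDiffAt_const))).add (hΓ k i j)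

/-- The BGG equation only involves the symmetrized Hessian, but partial derivatives commute and
Christoffel symbols are symmetric, so it can be solved for every second partial derivative. The
1-jet thus closes up with no further prolongation. -/
lemma pd_jet (hD : IsAffineConnectionOn D U) (hU : IsOpen U) {x y : M}
    (hy : y ∈ chartDom n x) (hyU : y ∈ U) {f : M → ℝ} (hf : SmoothFnAt n f y)
    (hbgg : ∀ i j, bggCoord D x f i j y = 0) (i : Fin (n + 1)) (α : Option (Fin (n + 1))) :
    pd x i (jet x f α) y = ∑ β, bggCoeff D x i α β y * jet x f β y := by
  rw [Fintype.sum_option]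
  cases α with
  | none => simp [bggCoeff, jet]
  | some j =>
    have hθ := fun i => (hD.christoffelTrace_smooth hU hy hyU i).mdiff
    have h1 : ∀ i j : Fin (n + 1), pd x i (covCoord D x (-1 / ((n : ℝ) + 2)) f j) y = pd x i (pd x j f) y
        - -1 / ((n : ℝ) + 2) * ((∑ k, christoffel D x k j k y) * pd x i f y
          + f y * pd x i (fun y => ∑ k, christoffel D x k j k y) y) := by
      intro i j
      have h2 : covCoord D x (-1 / ((n : ℝ) + 2)) f j = fun y => pd x j f y
          - -1 / ((n : ℝ) + 2) * ((∑ k, christoffel D x k j k y) * f y) := by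
        ext1 y
        rw [covCoord, mul_assoc]
      rw [h2, pd_sub x i (pd_smooth hy j hf).mdiff
        (g := fun y => _ * (_ * _)) (mdifferentiableAt_const.mul ((hθ j).mul hf.mdiff)),
        pd_const_mul x i _ (f := fun y => _ * _) ((hθ j).mul hf.mdiff), pd_mul x i (hθ j) hf.mdiff]
    have h3 : ∀ k, christoffel D x k j i y = christoffel D x k i j y :=
      fun k => hD.christoffel_symm hy hyU k j i
    have h4 : ∑ k, christoffel D x k i j y * covCoord D x (-1 / ((n : ℝ) + 2)) f k y =
        ∑ k, christoffel D x k i j y * pd x k f y - -1 / ((n : ℝ) + 2) *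
          (∑ l, christoffel D x l i j y * ∑ k, christoffel D x k l k y) * f y := by
      rw [Finset.mul_sum, Finset.sum_mul, ← Finset.sum_sub_distrib]
      refine Finset.sum_congr rfl fun k _ => ?_
      rw [covCoord]
      ring
    have h5 : ∑ k, bggCoeff D x i (some j) (some k) y * jet x f (some k) y =
        -1 / ((n : ℝ) + 2) * ((∑ k, christoffel D x k j k y) * pd x i f y
          + (∑ k, christoffel D x k i k y) * pd x j f y)
          + ∑ k, christoffel D x k i j y * pd x k f y := by
      simp only [bggCoeff, jet, add_mul, mul_add, Finset.sum_add_distrib, mul_assoc, ite_mul,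
        one_mul, zero_mul, mul_ite, mul_zero, Finset.sum_ite_eq, Finset.mem_univ, if_true]
    have h := hbgg i j
    rw [bggCoord, hessCoord, hessCoord, h1, h1, pd_comm hy j i hf] at h
    simp only [h3] at h
    rw [h4] at h
    simp only [covCoord] at h
    rw [h5]
    simp only [bggCoeff, jet]
    linear_combination h

/-- The derivative of a function in the preferred chart at `x`. -/
lemma hasFDerivWithinAt_comp_symm {x y : M} (hy : y ∈ chartDom n x) {f : M → ℝ}
    (hf : SmoothFnAt n f y) :
    HasFDerivWithinAt (f ∘ (extChartAt (Mdl n) x).symm)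
      (∑ j, pd x j f y • (EuclideanSpace.proj j : EuclideanSpace ℝ (Fin (n + 1)) →L[ℝ] ℝ))
      (range (Mdl n)) (extChartAt (Mdl n) x y) := by
  have h := ((contDiffWithinAt_comp_extChartAt_symm hy hf).differentiableWithinAt
    (by simp)).hasFDerivWithinAt
  set b := EuclideanSpace.basisFun (Fin (n + 1)) ℝ with hb
  refine h.congr_fderiv (ContinuousLinearMap.coe_injective (b.toBasis.ext fun i => ?_))
  refine (pd_eq_fderivWithin hy i hf.mdiff).symm.trans ?_
  simp [hb]

/-- Solutions of the first BGG equation on the interior extend smoothly to the boundary, and the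
`1`-jet of a nonzero solution does not vanish. -/
theorem exists_smooth_extension (hD : IsAffineConnectionOn D univ) {x : M} {f : M → ℝ}
    (hf : ∀ y ∈ (Mdl n).interior M ∩ chartDom n x, SmoothFnAt n f y)
    (hbgg : ∀ y ∈ (Mdl n).interior M ∩ chartDom n x, ∀ i j, bggCoord D x f i j y = 0) :
    ∃ (U : Set M) (g : M → ℝ), IsOpen U ∧ x ∈ U ∧ U ⊆ chartDom n x ∧
      (∀ y ∈ U, SmoothFnAt n g y) ∧ (∀ y ∈ U ∩ (Mdl n).interior M, g y = f y) ∧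
      ∀ y ∈ U, g y = 0 → mvfderiv (Mdl n) g y = 0 →
        ∀ z ∈ U ∩ (Mdl n).interior M, f z = 0 := by
  set φ := extChartAt (Mdl n) x with hφ
  have hdom : ∀ {z}, z ∈ φ.target → φ.symm z ∈ chartDom n x := fun {z} hz => by
    simpa [φ] using φ.map_target hz
  -- Halving the radius puts the closed ball inside the chart, so the coefficients are smooth on the
  -- whole compact closure of the half ball.
  obtain ⟨ε, hε, hball⟩ : ∃ ε > 0, Metric.closedBall (φ x) ε ∩ range (Mdl n) ⊆ φ.target := by
    obtain ⟨ε, hε, h⟩ := Metric.mem_nhdsWithin_iff.1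
      (extChartAt_target_mem_nhdsWithin (I := Mdl n) x)
    exact ⟨ε / 2, half_pos hε, (inter_subset_inter_left _
      (Metric.closedBall_subset_ball (half_lt_self hε))).trans h⟩
  have hrange : range (Mdl n) = {z | 0 ≤ z 0} := range_mdl
  set Ω := halfBall (φ x) ε with hΩ
  have hcl : closure Ω ⊆ φ.target := by
    refine (closure_halfBall_subset _ _).trans ?_
    rw [← hrange]
    exact hball
  have hcl' : closure Ω ⊆ range (Mdl n) := by
    rw [hrange]
    exact (closure_halfBall_subset _ _).trans inter_subset_right
  have hsub : Metric.ball (φ x) ε ∩ range (Mdl n) ⊆ closure Ω := by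
    rw [hrange]
    exact subset_closure_halfBall _ _
  have hne : Ω.Nonempty := closure_nonempty_iff.1
    ⟨φ x, hsub ⟨Metric.mem_ball_self hε, extChartAt_mem_range (mem_chartDom x)⟩⟩
  have hint : ∀ z ∈ Ω, φ.symm z ∈ (Mdl n).interior M := fun z hz => by
    have hz' := hcl (subset_closure hz)
    rw [mem_interior_iff (hdom hz'), ← hφ, φ.right_inv hz']
    exact hz.2
  obtain ⟨v, hvu, hv, hvd, hv0⟩ := LinearSystem.exists_extension
    (a := fun i α β => bggCoeff D x i α β ∘ φ.symm)
    (L := fun j => (EuclideanSpace.proj j : EuclideanSpace ℝ (Fin (n + 1)) →L[ℝ] ℝ))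
    (u := fun z α => jet x f α (φ.symm z))
    (isOpen_halfBall (φ x) ε) (convex_halfBall _ _) hne (isCompact_closure_halfBall _ _)
    (by
      intro j α β z hz
      have h := contDiffWithinAt_comp_extChartAt_symm (hdom (hcl hz))
        (bggCoeff_smooth hD isOpen_univ (hdom (hcl hz)) (mem_univ _) j α β)
      rw [← hφ, φ.right_inv (hcl hz)] at h
      exact h.mono hcl')
    (by
      intro z hz
      have hz' := hcl (subset_closure hz)
      have hmem : φ.symm z ∈ (Mdl n).interior M ∩ chartDom n x := ⟨hint z hz, hdom hz'⟩
      rw [hasFDerivAt_pi']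
      intro α
      have h := hasFDerivWithinAt_comp_symm (hdom hz') (jet_smooth (hdom hz') (hf _ hmem) α)
      rw [← hφ, φ.right_inv hz'] at h
      have h' := h.hasFDerivAt (Filter.mem_of_superset
        ((isOpen_halfBall (φ x) ε).mem_nhds hz) (subset_closure.trans hcl'))
      refine h'.congr_fderiv ?_
      simp only [pd_jet hD isOpen_univ (hdom hz') (mem_univ _) (hf _ hmem) (hbgg _ hmem)]
      rfl)
  set g : M → ℝ := fun y => v (φ y) none with hg
  set U : Set M := φ.source ∩ φ ⁻¹' Metric.ball (φ x) ε with hU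
  have hUdom : U ⊆ chartDom n x := fun y hy => by simpa [φ] using hy.1
  have hUcl : ∀ y ∈ U, φ y ∈ closure Ω := fun y hy =>
    hsub ⟨hy.2, extChartAt_mem_range (hUdom hy)⟩
  have hclnhds : ∀ y ∈ U, closure Ω ∈ 𝓝[range (Mdl n)] (φ y) := fun y hy =>
    Filter.mem_of_superset (Filter.inter_mem (mem_nhdsWithin_of_mem_nhds
      (Metric.isOpen_ball.mem_nhds hy.2)) self_mem_nhdsWithin) hsub
  have hgv : ∀ y ∈ U, g ∘ φ.symm =ᶠ[𝓝[range (Mdl n)] (φ y)] fun z => v z none := fun y hy => by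
    filter_upwards [hclnhds y hy] with z hz
    exact congrArg (fun z => v z none) (φ.right_inv (hcl hz))
  have hgf : ∀ y ∈ U ∩ (Mdl n).interior M, g y = f y := fun y hy => by
    have h : φ y ∈ Ω := ⟨hy.1.2, (mem_interior_iff (hUdom hy.1)).1 hy.2⟩
    rw [hg]
    simp only [hvu h, jet]
    rw [φ.left_inv hy.1.1]
  have hgs : ∀ y ∈ U, SmoothFnAt n g y := fun y hy => by
    have h : ContDiffWithinAt ℝ ∞ (fun z => v z none) (range (Mdl n)) (φ y) :=
      (contDiffWithinAt_pi.1 (hv _ (hUcl y hy)) none).mono_of_mem_nhdsWithin (hclnhds y hy)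
    have h' := h.congr_of_eventuallyEq_of_mem (hgv y hy) (extChartAt_mem_range (hUdom hy))
    exact (contMDiffAt_iff_source_of_mem_source (hUdom hy)).2
      (contMDiffWithinAt_iff_contDiffWithinAt.2 h')
  refine ⟨U, g, isOpen_extChartAt_preimage' x Metric.isOpen_ball, ⟨mem_extChartAt_source x,
    Metric.mem_ball_self hε⟩, hUdom, hgs, hgf, fun y hy h0 hd z hz => ?_⟩
  -- At a boundary point `v` is only known as a limit of 1-jets of `f`. The system itself identifies
  -- its remaining components with the derivatives of `g`.
  have hvz : v (φ y) = 0 := by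
    funext α
    cases α with
    | none => exact h0
    | some k =>
      have h1 := (hasFDerivWithinAt_pi'.1 (hvd _ (hUcl y hy)) none).mono_of_mem_nhdsWithin
        (hclnhds y hy)
      have h2 := HasFDerivWithinAt.congr_of_eventuallyEq h1 (hgv y hy)
        ((hgv y hy).eq_of_nhdsWithin (extChartAt_mem_range (hUdom hy)))
      have h3 := h2.fderivWithin ((Mdl n).uniqueDiffOn _ (extChartAt_mem_range (hUdom hy)))
      have h4 := pd_eq_fderivWithin (hUdom hy) k (hgs y hy).mdiff
      rw [← hφ, h3, pd, hd] at h4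
      -- The row `none` of the system reads `∂_k v_none = v_(some k)`.
      have h5 : LinearSystem.rhs (fun i α β => bggCoeff D x i α β ∘ φ.symm)
          (fun j => (EuclideanSpace.proj j : EuclideanSpace ℝ (Fin (n + 1)) →L[ℝ] ℝ)) (φ y)
          (v (φ y)) ((EuclideanSpace.basisFun (Fin (n + 1)) ℝ).toBasis k) none = v (φ y) (some k) := by
        simp [LinearSystem.rhs, Fintype.sum_option, bggCoeff]
      exact h5.symm.trans h4.symm
  have hz0 := hv0 _ (hUcl y hy) hvz (φ z) (hUcl z hz.1)
  rw [← hgf z hz, hg]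
  simp only [hz0]
  rfl

end ProjComp

/-! ### Ricci-flat special scales: boundary behaviour and the three conclusions. -/

namespace ProjComp

variable {n : ℕ} {M : Type*} [TopologicalSpace M] [ChartedSpace (EuclideanHalfSpace (n + 1)) M]
  {r : ℝ}

lemma DensitySection.extendByZero_of_mem (s : DensitySection n M r) {x : M}
    (hx : x ∈ (Mdl n).interior M) : s.extendByZero x = s x := if_pos hx

lemma notMem_interior {x : M} (hx : x ∈ (Mdl n).boundary M) : x ∉ (Mdl n).interior M :=
  disjoint_right.1 (Mdl n).disjoint_interior_boundary hx

lemma mem_interior_or_boundary (n : ℕ) {M : Type*} [TopologicalSpace M]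
    [ChartedSpace (EuclideanHalfSpace (n + 1)) M] (x : M) :
    x ∈ (Mdl n).interior M ∨ x ∈ (Mdl n).boundary M :=
  (Mdl n).isInteriorPoint_or_isBoundaryPoint x

lemma DensitySection.extendByZero_of_boundary (s : DensitySection n M r) {x : M}
    (hx : x ∈ (Mdl n).boundary M) : s.extendByZero x = 0 := if_neg (notMem_interior hx)

variable [IsManifold (Mdl n) ∞ M]

lemma covCoord_congr {D : Conn n M} {x y : M} {f g : M → ℝ} (h : f =ᶠ[𝓝 y] g) (r : ℝ)
    (i : Fin (n + 1)) : covCoord D x r f i =ᶠ[𝓝 y] covCoord D x r g i := by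
  filter_upwards [eventually_eventually_nhds.2 h] with z hz
  rw [covCoord, covCoord, pd_congr x i hz, Filter.EventuallyEq.eq_of_nhds hz]

lemma bggCoord_congr {D : Conn n M} {x y : M} {f g : M → ℝ} (h : f =ᶠ[𝓝 y] g)
    (i j : Fin (n + 1)) : bggCoord D x f i j y = bggCoord D x g i j y := by
  have hc := fun i => covCoord_congr (D := D) (x := x) h (-1 / ((n : ℝ) + 2)) i
  simp only [bggCoord, hessCoord, pd_congr x _ (hc _), (hc _).eq_of_nhds, h.eq_of_nhds]

lemma DensitySection.rep_extendByZero_of_mem (s : DensitySection n M r) (x : M) {y : M}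
    (hy : y ∈ (Mdl n).interior M) : s.extendByZero.rep x y = s.rep x y := by
  rw [rep, s.extendByZero_of_mem hy, rep]

lemma DensitySection.rep_extendByZero_of_boundary (s : DensitySection n M r) (x : M) {y : M}
    (hy : y ∈ (Mdl n).boundary M) : s.extendByZero.rep x y = 0 := by
  rw [rep, s.extendByZero_of_boundary hy]
  rfl

/-- The data of a Ricci-flat special affine connection on the interior, in the projective class. -/
structure IsRicciFlatSpecialScale (p : ProjectiveStructure n M) (D : Conn n M)
    (κ : DensitySection n M 1) : Prop where
  contains : p.ContainsOn D ((Mdl n).interior M)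
  smooth : κ.IsSmoothOn ((Mdl n).interior M)
  ne_zero : ∀ x ∈ (Mdl n).interior M, κ x ≠ 0
  parallel : κ.IsParallelOn D ((Mdl n).interior M)
  ricciFlat : IsRicciFlatOn D ((Mdl n).interior M)

namespace IsRicciFlatSpecialScale

variable {p : ProjectiveStructure n M} {D D₀ : Conn n M} {κ : DensitySection n M 1}

lemma rep_ne_zero (h : IsRicciFlatSpecialScale p D κ) {x y : M} (hy : y ∈ chartDom n x)
    (hyi : y ∈ (Mdl n).interior M) : κ.rep x y ≠ 0 := by
  have := h.ne_zero y hyi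
  rwa [Ne, Density.eq_zero_iff _ (coordBasis hy), coe_coordBasis] at this

lemma weightOne_pos (h : IsRicciFlatSpecialScale p D κ) {x y : M} (hy : y ∈ chartDom n x)
    (hyi : y ∈ (Mdl n).interior M) : 0 < DensitySection.rep (weightOneDensity κ) x y :=
  Real.rpow_pos_of_pos (abs_pos.2 (h.rep_ne_zero hy hyi)) _

lemma weightOne_smooth (h : IsRicciFlatSpecialScale p D κ) {x y : M} (hy : y ∈ chartDom n x)
    (hyi : y ∈ (Mdl n).interior M) :
    SmoothFnAt n (DensitySection.rep (weightOneDensity κ) x) y :=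
  (h.smooth.rep_smooth hy hyi).abs_rpow _ (h.rep_ne_zero hy hyi)

/-- Here parallelism of `κ` and Ricci-flatness of `D`, both statements about `D`, turn into an
equation for `D₀`, which is regular at the boundary. -/
lemma weightOne_bgg (h : IsRicciFlatSpecialScale p D κ) (hn : n ≠ 0) (hD₀ : D₀ ∈ p.carrier)
    {x y : M} (hy : y ∈ chartDom n x) (hyi : y ∈ (Mdl n).interior M) (i j : Fin (n + 1)) :
    bggCoord D₀ x (DensitySection.rep (weightOneDensity κ) x) i j y = 0 := by
  obtain ⟨Υ, hΥ, hch⟩ := h.contains.2 D₀ hD₀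
  have hric : ∀ i j, ricciCoord D x i j y = 0 := fun i j => by
    rw [← h.contains.1.ricci_coordField isOpen_interior_mdl hy hyi]
    exact h.ricciFlat y hyi _ _
  refine bggCoord_eq_zero hn (p.isAffine D₀ hD₀) isOpen_univ hch isOpen_interior_mdl
    (subset_univ _) hΥ hy hyi (h.weightOne_smooth hy hyi) (fun z hz k =>
      covCoord_weightOneDensity h.contains.1 hch isOpen_interior_mdl h.smooth h.ne_zero h.parallel
        hz.2 hz.1 k) (fun i j => by rw [hric, hric, add_zero]) i j

/-- The one-form relating the scale to a connection in the projective class, in terms of the weight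
one density. -/
lemma formCoord_eq (h : IsRicciFlatSpecialScale p D κ) {Υ : OneForm n M}
    (hch : IsProjectiveChangeOn D₀ D Υ ((Mdl n).interior M)) {x y : M} (hy : y ∈ chartDom n x)
    (hyi : y ∈ (Mdl n).interior M) (i : Fin (n + 1)) :
    formCoord Υ x i y = -1 / ((n : ℝ) + 2) * ∑ k, christoffel D₀ x k i k y
      - pd x i (DensitySection.rep (weightOneDensity κ) x) y /
        DensitySection.rep (weightOneDensity κ) x y := by
  have h1 := covCoord_weightOneDensity h.contains.1 hch isOpen_interior_mdl h.smooth h.ne_zero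
    h.parallel hy hyi i
  have h2 := (h.weightOne_pos hy hyi).ne'
  rw [covCoord] at h1
  rw [eq_sub_iff_add_eq, ← sub_eq_zero]
  field_simp at h1 ⊢
  linear_combination h1

/-- The weight one density vanishes along the boundary if the connection does not extend. -/
lemma eq_zero_of_not_extendsTo (h : IsRicciFlatSpecialScale p D κ)
    (hext : ∀ x ∈ (Mdl n).boundary M, ∀ U : Set M, IsOpen U → x ∈ U → ¬ ExtendsTo D U)
    {x : M} {U : Set M} (hU : IsOpen U) (hUx : U ⊆ chartDom n x) {g : M → ℝ}
    (hg : ∀ y ∈ U, SmoothFnAt n g y) (hgf : ∀ y ∈ U ∩ (Mdl n).interior M,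
      g y = DensitySection.rep (weightOneDensity κ) x y) {y : M} (hy : y ∈ U)
    (hyb : y ∈ (Mdl n).boundary M) : g y = 0 := by
  by_contra hne
  obtain ⟨D₀, hD₀⟩ := p.nonempty
  have haff := p.isAffine D₀ hD₀
  obtain ⟨Υ, hΥ, hch⟩ := h.contains.2 D₀ hD₀
  have hcont : ContinuousOn g U := fun z hz => (hg z hz).continuousAt.continuousWithinAt
  have hV : IsOpen (U ∩ g ⁻¹' {0}ᶜ) := hcont.isOpen_inter_preimage hU isOpen_compl_singleton
  set V := U ∩ g ⁻¹' {0}ᶜ with hVdef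
  have hVx : V ⊆ chartDom n x := inter_subset_left.trans hUx
  -- These are the components of `Υ` from `formCoord_eq` with `σ` replaced by its smooth extension
  -- `g`. They are smooth wherever `g ≠ 0`, so on `V` they would extend `D` across the boundary.
  set c : Fin (n + 1) → M → ℝ := fun i z =>
    -1 / ((n : ℝ) + 2) * ∑ k, christoffel D₀ x k i k z - pd x i g z / g z with hc
  refine hext y hyb V hV ⟨hy, hne⟩ ⟨projChange D₀ (formOfCoord x c),
    haff.projChange (subset_univ _) (formOfCoord_isSmoothOn hVx fun i z hz => ?_), ?_⟩
  · exact (contMDiffAt_const.mul (haff.christoffelTrace_smooth isOpen_univ (hVx hz) (mem_univ _)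
      i)).sub ((pd_smooth (hVx hz) i (hg z hz.1)).div₀ (hg z hz.1) hz.2)
  · intro z hz Y hY
    have hzx := hVx hz.1
    have hgz : g =ᶠ[𝓝 z] DensitySection.rep (weightOneDensity κ) x := by
      filter_upwards [hU.mem_nhds hz.1.1, isOpen_interior_mdl.mem_nhds hz.2] with z' h1 h2
      exact hgf z' ⟨h1, h2⟩
    have hform : formOfCoord x c z = Υ z := by
      refine form_ext hzx fun i => ?_
      rw [formCoord_formOfCoord hzx, h.formCoord_eq hch hzx hz.2, pd_congr x i hgz.symm,
        ← hgz.eq_of_nhds]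
    ext1 v
    rw [projChange_apply, hform, hch z hz.2 Y hY]

/-- The weight one density is represented by defining functions near boundary points. -/
lemma exists_isDefiningFunctionOn (h : IsRicciFlatSpecialScale p D κ) (hn : n ≠ 0)
    (hext : ∀ x ∈ (Mdl n).boundary M, ∀ U : Set M, IsOpen U → x ∈ U → ¬ ExtendsTo D U) (x : M) :
    ∃ U : Set M, IsOpen U ∧ x ∈ U ∧ U ⊆ chartDom n x ∧
      IsDefiningFunctionOn (n := n)
        (DensitySection.rep (DensitySection.extendByZero (weightOneDensity κ)) x) U := by
  obtain ⟨D₀, hD₀⟩ := p.nonempty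
  obtain ⟨U, g, hU, hxU, hUx, hg, hgf, hjet⟩ := exists_smooth_extension (p.isAffine D₀ hD₀)
    (f := DensitySection.rep (weightOneDensity κ) x)
    (fun y hy => h.weightOne_smooth hy.2 hy.1)
    (fun y hy => h.weightOne_bgg hn hD₀ hy.2 hy.1)
  have heq : ∀ y ∈ U, DensitySection.rep (DensitySection.extendByZero (weightOneDensity κ)) x y
      = g y := by
    intro y hy
    rcases mem_interior_or_boundary n y with hi | hb
    · rw [DensitySection.rep_extendByZero_of_mem _ _ hi, hgf y ⟨hy, hi⟩]
    · rw [DensitySection.rep_extendByZero_of_boundary _ _ hb,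
        h.eq_zero_of_not_extendsTo hext hU hUx hg hgf hy hb]
  have hgpos : ∀ y ∈ U ∩ (Mdl n).interior M, 0 < g y := fun y hy => by
    rw [hgf y hy]
    exact h.weightOne_pos (hUx hy.1) hy.2
  have heq' : ∀ y ∈ U, DensitySection.rep (DensitySection.extendByZero (weightOneDensity κ)) x
      =ᶠ[𝓝 y] g := fun y hy => by
    filter_upwards [hU.mem_nhds hy] with z hz using heq z hz
  refine ⟨U, hU, hxU, hUx, ?_, ?_, ?_, ?_⟩
  · exact fun y hy => ((hg y hy).congr_of_eventuallyEq (heq' y hy)).contMDiffWithinAt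
  · intro y hy
    rcases mem_interior_or_boundary n y with hi | hb
    · rw [heq y hy]
      exact (hgpos y ⟨hy, hi⟩).le
    · rw [DensitySection.rep_extendByZero_of_boundary _ _ hb]
  · intro y hy
    refine ⟨fun h0 => ?_, fun hb => DensitySection.rep_extendByZero_of_boundary _ _ hb⟩
    refine (mem_interior_or_boundary n y).resolve_left fun hi => ?_
    rw [heq y hy] at h0
    exact (hgpos y ⟨hy, hi⟩).ne' h0
  · intro y hy h0 hd
    rw [heq y hy] at h0
    rw [mvfderiv_congr (heq' y hy)] at hd
    -- A vanishing 1-jet would make the density zero at all interior points of `U`. There is at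
    -- least one, and the density is positive there.
    obtain ⟨z, hzU, hzi⟩ := mem_closure_iff.1 (mem_closure_interior (n := n) x) U hU hxU
    exact (h.weightOne_pos (hUx hzU) hzi).ne' (hjet y hy h0 hd z ⟨hzU, hzi⟩)

lemma isDefiningDensity (h : IsRicciFlatSpecialScale p D κ) (hn : n ≠ 0)
    (hext : ∀ x ∈ (Mdl n).boundary M, ∀ U : Set M, IsOpen U → x ∈ U → ¬ ExtendsTo D U) :
    IsDefiningDensity (DensitySection.extendByZero (weightOneDensity κ)) where
  smooth := fun x _ => by
    obtain ⟨U, hU, hxU, -, hdef⟩ := h.exists_isDefiningFunctionOn hn hext x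
    exact (hdef.smooth x hxU).contMDiffAt (hU.mem_nhds hxU)
  zero_iff := fun x => by
    refine ⟨fun h0 => (mem_interior_or_boundary n x).resolve_left fun hi => ?_,
      fun hb => DensitySection.extendByZero_of_boundary _ hb⟩
    rw [DensitySection.extendByZero_of_mem _ hi,
      Density.eq_zero_iff _ (coordBasis (mem_chartDom (n := n) x)), coe_coordBasis] at h0
    exact (h.weightOne_pos (mem_chartDom x) hi).ne' h0
  rep := fun x _ => by
    obtain ⟨U, hU, hxU, -, hdef⟩ := h.exists_isDefiningFunctionOn hn hext x
    exact ⟨U, hU, hxU, hdef⟩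

/-- In `formCoord_eq` the only singular part of `Υ` is `-dρ/ρ`. Adding `dρ/ρ` leaves a multiple of
the Christoffel trace of `D₀`, smooth up to the boundary. -/
lemma isProjectivelyCompact (h : IsRicciFlatSpecialScale p D κ) (hn : n ≠ 0)
    (hext : ∀ x ∈ (Mdl n).boundary M, ∀ U : Set M, IsOpen U → x ∈ U → ¬ ExtendsTo D U) :
    IsProjectivelyCompact 1 D := by
  intro x _
  obtain ⟨U, hU, hxU, hUx, hdef⟩ := h.exists_isDefiningFunctionOn hn hext x
  obtain ⟨D₀, hD₀⟩ := p.nonempty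
  have haff := p.isAffine D₀ hD₀
  obtain ⟨Υ, hΥ, hch⟩ := h.contains.2 D₀ hD₀
  set ρ := DensitySection.rep (DensitySection.extendByZero (weightOneDensity κ)) x with hρ
  set c : Fin (n + 1) → M → ℝ := fun i z =>
    -1 / ((n : ℝ) + 2) * ∑ k, christoffel D₀ x k i k z with hc
  refine ⟨U, ρ, projChange D₀ (formOfCoord x c), hU, hxU, hdef, haff.projChange (subset_univ _)
    (formOfCoord_isSmoothOn hUx fun i z hz => contMDiffAt_const.mul
      (haff.christoffelTrace_smooth isOpen_univ (hUx hz) (mem_univ _) i)), ?_⟩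
  intro z hz Y hY v
  have hzx := hUx hz.1
  have hρz : ρ =ᶠ[𝓝 z] DensitySection.rep (weightOneDensity κ) x := by
    filter_upwards [isOpen_interior_mdl.mem_nhds hz.2] with z' h'
    exact DensitySection.rep_extendByZero_of_mem _ _ h'
  have hform : ∀ u, formOfCoord x c z u =
      Υ z u + ((1 / (1 * ρ z)) • mvfderiv (Mdl n) ρ z : TangentSpace (Mdl n) z →L[ℝ] ℝ) u := by
    have h1 : formOfCoord x c z = (fun z => Υ z + (1 / (1 * ρ z)) • mvfderiv (Mdl n) ρ z) z := by
      refine form_ext (Υ' := fun z => Υ z + (1 / (1 * ρ z)) • mvfderiv (Mdl n) ρ z) hzx fun i => ?_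
      rw [formCoord_formOfCoord hzx, formCoord]
      have h2 : (Υ z + (1 / (1 * ρ z)) • mvfderiv (Mdl n) ρ z) (coordField x i z) =
          formCoord Υ x i z + 1 / (1 * ρ z) * pd x i ρ z := rfl
      rw [h2, h.formCoord_eq hch hzx hz.2, pd_congr x i hρz, hρz.eq_of_nhds, hc]
      ring
    intro u
    rw [h1]
    rfl
  rw [projChange_apply, hform, hform, hch z hz.2 Y hY]
  module

lemma solvesFirstBGG (h : IsRicciFlatSpecialScale p D κ) (hn : n ≠ 0)
    (hext : ∀ x ∈ (Mdl n).boundary M, ∀ U : Set M, IsOpen U → x ∈ U → ¬ ExtendsTo D U) :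
    SolvesFirstBGG p (DensitySection.extendByZero (weightOneDensity κ)) := by
  intro D₀ hD₀ x v w
  have haff := p.isAffine D₀ hD₀
  have hxx := mem_chartDom (n := n) x
  set σ : DensitySection n M (-1 / ((n : ℝ) + 2)) :=
    DensitySection.extendByZero (weightOneDensity κ) with hσ
  have hs : σ.IsSmoothOn univ := (h.isDefiningDensity hn hext).smooth
  have hsx : SmoothFnAt n (σ.rep x) x := hs x (mem_univ _)
  have hbgg : ∀ i j, bggCoord D₀ x (σ.rep x) i j x = 0 := by
    intro i j
    have hc : ContinuousAt (bggCoord D₀ x (σ.rep x) i j) x := by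
      have hH := fun i j => hessCoord_smooth haff isOpen_univ hxx (mem_univ _) hsx
        (-1 / ((n : ℝ) + 2)) i j
      have hR := fun i j => haff.ricciCoord_smooth isOpen_univ hxx (mem_univ _) i j
      exact ((((hH i j).continuousAt.add (hH j i).continuousAt).div_const 2).add
        ((continuousAt_const.mul (((hR i j).continuousAt.add (hR j i).continuousAt).div_const
          2)).mul hsx.continuousAt))
    -- The BGG expression is continuous, so a nonzero value at `x` would persist at nearby interior
    -- points, where it vanishes by `weightOne_bgg`.
    by_contra hne
    have hev := (hc.eventually_ne hne).and (chartDom_mem_nhds hxx)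
    obtain ⟨y, ⟨hy, hyx⟩, hyi⟩ := ((mem_closure_iff_frequently.1
      (mem_closure_interior (n := n) x)).and_eventually hev).exists.imp fun y hy => hy.symm
    refine hy ?_
    have he : σ.rep x =ᶠ[𝓝 y] DensitySection.rep (weightOneDensity κ) x := by
      filter_upwards [isOpen_interior_mdl.mem_nhds hyi] with z hz
      exact DensitySection.rep_extendByZero_of_mem _ _ hz
    rw [bggCoord_congr he, h.weightOne_bgg hn hD₀ hyx hyi]
  rw [Density.eq_zero_iff _ (stdBasis x)]
  have h1 := DensitySection.hess_stdBasis haff isOpen_univ hs (mem_univ x)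
  have h2 : (DensitySection.hess D₀ σ x w v).1 (stdBasis x) = ∑ i, ∑ j, coordCoeff x i x v *
      coordCoeff x j x w * hessCoord D₀ x (-1 / ((n : ℝ) + 2)) (σ.rep x) j i x := by
    rw [h1, Finset.sum_comm]
    simp only [mul_comm (coordCoeff x _ x w) (coordCoeff x _ x v)]
  have h3 := haff.ricci_eq isOpen_univ hxx (mem_univ _) (x := x)
  have h4 : ricci D₀ x w v = ∑ i, ∑ j, coordCoeff x i x v * coordCoeff x j x w *
      ricciCoord D₀ x j i x := by
    rw [h3, Finset.sum_comm]
    simp only [mul_comm (coordCoeff x _ x w) (coordCoeff x _ x v)]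
  have h5 : (σ x).1 (stdBasis x) = σ.rep x x := by
    rw [DensitySection.rep, frame_self]
  change 1 / 2 * ((DensitySection.hess D₀ σ x v w).1 (stdBasis x)
    + (DensitySection.hess D₀ σ x w v).1 (stdBasis x))
    + schoutenSymm D₀ x v w * (σ x).1 (stdBasis x) = 0
  rw [h1, h2, schoutenSymm, h4, h3, h5]
  have h6 : ∑ i, ∑ j, coordCoeff x i x v * coordCoeff x j x w *
      bggCoord D₀ x (σ.rep x) i j x = 0 := by
    simp [hbgg]
  rw [← h6]
  simp only [bggCoord, ← Finset.sum_add_distrib, Finset.mul_sum, Finset.sum_div, Finset.sum_mul]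
  refine Finset.sum_congr rfl fun i _ => Finset.sum_congr rfl fun j _ => ?_
  ring

end IsRicciFlatSpecialScale

end ProjComp

end

theorem theorem3 {n : ℕ} (hn : 1 ≤ n) {M : Type*} [TopologicalSpace M] [T2Space M]
    [SecondCountableTopology M] [ChartedSpace (EuclideanHalfSpace (n + 1)) M]
    [IsManifold (ProjComp.Mdl n) ∞ M]
    (p : ProjComp.ProjectiveStructure n M) (D : ProjComp.Conn n M)
    (hD : p.ContainsOn D ((ProjComp.Mdl n).interior M))
    (κ : ProjComp.DensitySection n M 1)
    (hκ_smooth : κ.IsSmoothOn ((ProjComp.Mdl n).interior M))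
    (hκ_ne : ∀ x ∈ (ProjComp.Mdl n).interior M, κ x ≠ 0)
    (hκ_parallel : κ.IsParallelOn D ((ProjComp.Mdl n).interior M))
    (hRic : ProjComp.IsRicciFlatOn D ((ProjComp.Mdl n).interior M))
    (hext : ∀ x ∈ (ProjComp.Mdl n).boundary M, ∀ U : Set M, IsOpen U → x ∈ U →
      ¬ ProjComp.ExtendsTo D U) :
    ProjComp.IsProjectivelyCompact 1 D ∧
      ProjComp.IsDefiningDensity
        (ProjComp.DensitySection.extendByZero (ProjComp.weightOneDensity κ)) ∧
      ProjComp.SolvesFirstBGG p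
        (ProjComp.DensitySection.extendByZero (ProjComp.weightOneDensity κ)) := by
  have hn0 : n ≠ 0 := Nat.one_le_iff_ne_zero.1 hn
  have h : ProjComp.IsRicciFlatSpecialScale p D κ :=
    ⟨hD, hκ_smooth, hκ_ne, hκ_parallel, hRic⟩
  exact ⟨h.isProjectivelyCompact hn0 hext, h.isDefiningDensity hn0 hext,
    h.solvesFirstBGG hn0 hext⟩
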